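/- Let $T=\{t_n\}$ be an infinite, strictly increasing, one-sided or two-sided sequence of nonzero real numbers with $|t_n|\to\infty$ as $|n|\to\infty$, and let $\mu=\sum_n\mu_n\delta_{t_n}$, $\mu_n>0$, be a measure with $\int_{\mathbb R}\frac{d\mu(t)}{1+t^2}<\infty$. Assume that $T$ is power separated: there exist $C>0$ and $N\in\mathbb N$ such that $|t_{n+1}-t_n|\ge C|t_n|^{-N}$ for all consecutive indices $n,n+1$. Let $$\mathcal H(T,\mu)=\Big\{f:\mathbb C\setminus T\to\mathbb C\ :\ f(z)=\sum_n\frac{a_n\mu_n^{1/2}}{z-t_n},\ a=\{a_n\}\in\ell^2\Big\},$$ and for $f\in\mathcal H(T,\mu)$ with coefficients $a_n$ (which are determined by $f$) put $\mathcal Z_f=\{w\in\mathbb C\setminus T: f(w)=0\}\cup\{t_n\in T: a_n=0\}$. We say that $\mathcal H(T,\mu)$ has the strong localization property if there exists a sequence of pairwise disjoint open disks $D(t_n,r_n)$, $r_n>0$, such that for every nonzero $f\in\mathcal H(T,\mu)$ the disk $D(t_n,r_n)$ contains exactly one point of $\mathcal Z_f$ for all $n$ except, possibly, a finite number. Then $\mathcal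 H(T,\mu)$ has the strong localization property if and only if all polynomials belong to $L^2(\mu)$ and are dense in $L^2(\mu)$. -/

import Mathlib

open MeasureTheory Filter Topology

noncomputable section

namespace CauchyLocalization

/-- The measure `∑ₙ μₙ δ_{tₙ}` on the real line. -/
def discreteMeasure {I : Set ℤ} (t μ : I → ℝ) : Measure ℝ :=
  Measure.sum fun n : I => ENNReal.ofReal (μ n) • Measure.dirac (t n)

/-- `t` is an infinite, strictly increasing, one- or two-sided real sequence avoiding `0` with
`|tₙ| → ∞` as `|n| → ∞`, and `μₙ > 0` are masses with `∫ dμ(x) / (1 + x²) < ∞`. The index set `I`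
is an infinite interval of integers: a left half-line, a right half-line, or all of `ℤ`. -/
structure IsAdmissible (I : Set ℤ) (t μ : I → ℝ) : Prop where
  ordConnected : I.OrdConnected
  infinite : I.Infinite
  strictMono : StrictMono t
  tendsto_abs : Tendsto (fun n => |t n|) cofinite atTop
  ne_zero : ∀ n, t n ≠ 0
  mass_pos : ∀ n, 0 < μ n
  integrable : Integrable (fun x : ℝ => 1 / (1 + x ^ 2)) (discreteMeasure t μ)

/-- `|tₙ₊₁ - tₙ| ≥ C |tₙ|^{-N}` for all consecutive indices. -/
def IsPowerSeparated {I : Set ℤ} (t : I → ℝ) : Prop :=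
  ∃ C : ℝ, 0 < C ∧ ∃ N : ℕ, ∀ n m : I, (m : ℤ) = n + 1 →
    C * |t n| ^ (-(N : ℤ)) ≤ |t m - t n|

/-- The set `T = {tₙ}`, as a subset of the complex plane. -/
def nodeSet {I : Set ℤ} (t : I → ℝ) : Set ℂ :=
  Set.range fun n => (t n : ℂ)

/-- The function `f(z) = ∑ₙ aₙ μₙ^{1/2} / (z - tₙ)` on `ℂ ∖ T`, for `a ∈ ℓ²`. -/
def cauchyTransform {I : Set ℤ} (t μ : I → ℝ) (a : lp (fun _ : I => ℂ) 2) :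
    ((nodeSet t)ᶜ : Set ℂ) → ℂ :=
  fun z => ∑' n : I, a n * (Real.sqrt (μ n) : ℂ) / ((z : ℂ) - (t n : ℂ))

/-- The space `H(T, μ)` of Cauchy transforms, as a set of functions on `ℂ ∖ T`. -/
def cauchySpace {I : Set ℤ} (t μ : I → ℝ) : Set (((nodeSet t)ᶜ : Set ℂ) → ℂ) :=
  Set.range (cauchyTransform t μ)

/-- The modified zero set `Z_f = {w ∈ ℂ ∖ T : f w = 0} ∪ {tₙ : aₙ = 0}`, where `a` is the coefficient
sequence of `f` (which `f` determines). -/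
def zeroSet {I : Set ℤ} (t μ : I → ℝ) (f : ((nodeSet t)ᶜ : Set ℂ) → ℂ) : Set ℂ :=
  {w | ∃ h : w ∈ (nodeSet t)ᶜ, f ⟨w, h⟩ = 0} ∪
    {w | ∃ a : lp (fun _ : I => ℂ) 2, f = cauchyTransform t μ a ∧
      ∃ n : I, w = (t n : ℂ) ∧ a n = 0}

/-- There are pairwise disjoint open disks `D(tₙ, rₙ)` such that, for every nonzero
`f ∈ H(T, μ)`, all but finitely many of them contain exactly one point of `Z_f`. -/
def StrongLocalization {I : Set ℤ} (t μ : I → ℝ) : Prop :=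
  ∃ r : I → ℝ, (∀ n, 0 < r n) ∧
    (Pairwise fun n m : I => Disjoint (Metric.ball (t n : ℂ) (r n)) (Metric.ball (t m : ℂ) (r m))) ∧
    ∀ f ∈ cauchySpace t μ, f ≠ 0 →
      {n : I | ¬ ∃! w : ℂ, w ∈ zeroSet t μ f ∩ Metric.ball (t n : ℂ) (r n)}.Finite

/-- All polynomials are in `L²(ν)`. -/
def PolynomialsInL2 (ν : Measure ℝ) : Prop :=
  ∀ p : Polynomial ℂ, MemLp (fun x : ℝ => p.eval (x : ℂ)) 2 ν

/-- The classes of polynomials are dense in the Hilbert space `L²(ν)`. -/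
def PolynomialsDenseInL2 (ν : Measure ℝ) : Prop :=
  Dense {g : Lp ℂ 2 ν | ∃ p : Polynomial ℂ, g =ᵐ[ν] fun x : ℝ => p.eval (x : ℂ)}

end CauchyLocalization

end

/-! Write `c n = a n * √(μ n)` and `f z = ∑ c n / (z - t n)`.

Localization implies density. A zero `w` of `f` can be moved to `u`: by partial fractions,
multiplying each `c n` by `(1 - t n / u) / (1 - t n / w)` multiplies `f` by `(1 - z / u) / (1 - z /
w)`. Infinitely many zeros can be moved at once along a sparse subsequence, polynomial growth of the
cost being paid for by deleting finitely many other zeros (`ZeroMoves.exists_limit`). Pushing simple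
zeros onto the boundary circles of their disks, or splitting double zeros inside them, would
contradict localization (`not_infinite_movable`). Hence, wherever `a n ≠ 0`, the zero in the `n`-th
disk approaches `t n` faster than any power (`finite_not_close`). Isolating the pole at `t n` in the
equation `f w = 0` compares `c n` with the distance from `w` to `t n`, so the masses also decay
faster than any power (`finite_mass_gt`) and polynomials are in `L²`. A vector orthogonal to the
polynomials corresponds to an `f` whose coefficients have vanishing power moments. Such an `f` is
`O(1 / |z|)` on suitable large circles, the product of `(t n - z) / (w n - z)` cancels its poles
inside while staying bounded there, and the maximum principle gives `f = 0`
(`nodeSum_eq_zero_of_close_zeros`).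

Density implies localization. A nonzero `f` has a first nonzero moment `M`, of order `K` say, and
then `z ^ (K + 1) * f z = M * (1 + ∑ d n / (z - t n))` with rapidly decaying `d`. Near a distant
node only the `n`-th term competes with `1`, so the zeros there are fixed points of a contraction
(`exists_localizingRadii`). Disks of radius about half the separation work for every `f`. -/

noncomputable section

namespace CauchyLocalization

/-! ### Sums of simple fractions and the cancellation of their zeros -/

section NodeSums

variable {ι : Type*} {t : ι → ℝ} {c : ι → ℂ}

/-- The sum `∑ₙ cₙ / (z - tₙ)`. -/
def nodeSum (t : ι → ℝ) (c : ι → ℂ) (z : ℂ) : ℂ := ∑' n, c n / (z - t n)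

/-- The sum `∑ₙ cₙ / (z - tₙ)²`, which is minus the derivative of `nodeSum`. -/
def nodeSqSum (t : ι → ℝ) (c : ι → ℂ) (z : ℂ) : ℂ := ∑' n, c n / (z - t n) ^ 2

/-- All but finitely many nodes satisfy `|t n| ≥ 2‖z‖ + 1`, where the constant `2` suffices; the
finitely many others are absorbed by a finite sum. -/
lemma exists_weight_le (ht : Tendsto (fun n => |t n|) cofinite atTop) {z : ℂ}
    (hz : ∀ n, z ≠ t n) : ∃ C : ℝ, 0 < C ∧ ∀ n, 1 + |t n| ≤ C * ‖z - t n‖ := by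
  have hev := ht.eventually_ge_atTop (2 * ‖z‖ + 1)
  have hfin : {n | ¬ (2 * ‖z‖ + 1 ≤ |t n|)}.Finite := hev
  have hpos : ∀ n, 0 < ‖z - t n‖ := fun n => norm_pos_iff.2 (sub_ne_zero.2 (hz n))
  have hnn : ∀ n, 0 ≤ (1 + |t n|) / ‖z - t n‖ := fun n => by positivity
  refine ⟨2 + ∑ n ∈ hfin.toFinset, (1 + |t n|) / ‖z - t n‖,
    by have := Finset.sum_nonneg (fun n (_ : n ∈ hfin.toFinset) => hnn n); linarith, fun n => ?_⟩
  by_cases hn : 2 * ‖z‖ + 1 ≤ |t n|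
  · have h1 : |t n| ≤ ‖z - t n‖ + ‖z‖ := by
      have : ‖(t n : ℂ)‖ ≤ ‖z - t n‖ + ‖z‖ := by
        have := norm_sub_le z (z - t n)
        rw [sub_sub_cancel] at this; linarith
      simpa using this
    have h2 := mul_nonneg (Finset.sum_nonneg fun n (_ : n ∈ hfin.toFinset) => hnn n) (hpos n).le
    rw [add_mul]; linarith
  · have h1 : (1 + |t n|) / ‖z - t n‖ ≤ ∑ n ∈ hfin.toFinset, (1 + |t n|) / ‖z - t n‖ :=
      Finset.single_le_sum (f := fun n => (1 + |t n|) / ‖z - t n‖) (fun n _ => hnn n)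
        (hfin.mem_toFinset.2 hn)
    rw [← div_le_iff₀ (hpos n)]
    linarith

lemma summable_div_sub (hc : Summable fun n => ‖c n‖ / (1 + |t n|)) {z : ℂ} {C : ℝ}
    (hz : ∀ n, z ≠ t n) (hC : ∀ n, 1 + |t n| ≤ C * ‖z - t n‖) :
    Summable fun n => c n / (z - t n) := by
  refine Summable.of_norm_bounded (hc.mul_left C) fun n => ?_
  have hpos : 0 < ‖z - t n‖ := norm_pos_iff.2 (sub_ne_zero.2 (hz n))
  have h1 : 0 < 1 + |t n| := by positivity
  rw [norm_div, div_le_iff₀ hpos, mul_div_assoc', div_mul_eq_mul_div, le_div_iff₀ h1]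
  nlinarith [hC n, norm_nonneg (c n)]

lemma summable_div_sub_sq (hc : Summable fun n => ‖c n‖ / (1 + |t n|)) {z : ℂ} {C : ℝ}
    (hz : ∀ n, z ≠ t n) (hC : ∀ n, 1 + |t n| ≤ C * ‖z - t n‖) :
    Summable fun n => c n / (z - t n) ^ 2 := by
  refine Summable.of_norm_bounded ((summable_div_sub hc hz hC).norm.mul_left C) fun n => ?_
  have hpos : 0 < ‖z - t n‖ := norm_pos_iff.2 (sub_ne_zero.2 (hz n))
  rw [norm_div, norm_div, norm_pow, div_le_iff₀ (by positivity), mul_div_assoc',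
    div_mul_eq_mul_div, le_div_iff₀ hpos]
  have h1 : 1 ≤ C * ‖z - t n‖ := le_trans (by simp) (hC n)
  nlinarith [mul_nonneg (norm_nonneg (c n)) hpos.le, mul_nonneg (mul_nonneg (norm_nonneg (c n)) hpos.le) (sub_nonneg.2 h1)]

lemma summable_weight_mul (hc : Summable fun n => ‖c n‖ / (1 + |t n|)) {b : ι → ℂ} {C : ℝ}
    (hb : ∀ n, ‖b n‖ ≤ C) : Summable fun n => ‖c n * b n‖ / (1 + |t n|) := by
  refine Summable.of_nonneg_of_le (fun n => by positivity) (fun n => ?_) (hc.mul_left C)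
  rw [norm_mul, mul_div_assoc', mul_comm C]
  gcongr
  exact hb n

lemma exists_norm_factor_le (ht : Tendsto (fun n => |t n|) cofinite atTop) (α β : ℂ) {w : ℂ}
    (hw : ∀ n, w ≠ t n) : ∃ C : ℝ, ∀ n, ‖(α - β * t n) / (w - t n)‖ ≤ C := by
  obtain ⟨C, hC0, hC⟩ := exists_weight_le ht hw
  refine ⟨(‖α‖ + ‖β‖) * C, fun n => ?_⟩
  have hpos : 0 < ‖w - t n‖ := norm_pos_iff.2 (sub_ne_zero.2 (hw n))
  rw [norm_div, div_le_iff₀ hpos]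
  have h1 : ‖α - β * t n‖ ≤ ‖α‖ + ‖β‖ * |t n| := by
    refine (norm_sub_le _ _).trans ?_
    simp
  have h2 := mul_le_mul_of_nonneg_left (hC n) (add_nonneg (norm_nonneg α) (norm_nonneg β))
  nlinarith [norm_nonneg α, norm_nonneg β, abs_nonneg (t n), mul_nonneg (norm_nonneg α) (abs_nonneg (t n))]

variable (ht : Tendsto (fun n => |t n|) cofinite atTop)
  (hc : Summable fun n => ‖c n‖ / (1 + |t n|)) {α β w z : ℂ}

-- Partial fractions: the discrepancy between the two sides is a multiple of `∑ c n / (w - t n)`,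
-- which vanishes because `w` is a zero. This is the mechanism by which a zero is removed (`β = 0`)
-- or moved.
include ht hc in
lemma nodeSum_mul_factor (hw : ∀ n, w ≠ t n) (hz : ∀ n, z ≠ t n) (hzw : z ≠ w)
    (h0 : nodeSum t c w = 0) :
    nodeSum t (fun n => c n * ((α - β * t n) / (w - t n))) z =
      nodeSum t c z * ((α - β * z) / (w - z)) := by
  obtain ⟨C, -, hC⟩ := exists_weight_le ht hw
  obtain ⟨C', -, hC'⟩ := exists_weight_le ht hz
  have hs1 := summable_div_sub hc hw hC
  have hs2 := summable_div_sub hc hz hC'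
  have key : ∀ n, c n * ((α - β * t n) / (w - t n)) / (z - t n) =
      (c n / (z - t n)) * ((α - β * z) / (w - z)) -
        (c n / (w - t n)) * ((α - β * w) / (w - z)) := fun n => by
    have h1 := sub_ne_zero.2 (hw n)
    have h2 := sub_ne_zero.2 (hz n)
    have h3 := sub_ne_zero.2 hzw.symm
    field_simp
    ring
  unfold nodeSum at h0 ⊢
  simp_rw [key]
  rw [(hs2.mul_right _).tsum_sub (hs1.mul_right _), tsum_mul_right, tsum_mul_right, h0]
  ring

include ht hc in
lemma nodeSum_mul_factor_self (hw : ∀ n, w ≠ t n) (h0 : nodeSum t c w = 0) :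
    nodeSum t (fun n => c n * ((α - β * t n) / (w - t n))) w =
      nodeSqSum t c w * (α - β * w) := by
  obtain ⟨C, -, hC⟩ := exists_weight_le ht hw
  have hs1 := summable_div_sub hc hw hC
  have hs2 := summable_div_sub_sq hc hw hC
  have key : ∀ n, c n * ((α - β * t n) / (w - t n)) / (w - t n) =
      (c n / (w - t n) ^ 2) * (α - β * w) + (c n / (w - t n)) * β := fun n => by
    have h1 := sub_ne_zero.2 (hw n)
    field_simp
    ring
  unfold nodeSum at h0 ⊢
  simp_rw [key]
  rw [(hs2.mul_right _).tsum_add (hs1.mul_right _), tsum_mul_right, tsum_mul_right, h0, nodeSqSum]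
  ring

-- Derivatives at a remaining zero follow the product rule, whose second term drops out there. This
-- carries the multiplicity of a zero through the cancellation of the others.
include ht hc in
lemma nodeSqSum_mul_factor (hw : ∀ n, w ≠ t n) (hz : ∀ n, z ≠ t n) (hzw : z ≠ w)
    (h0 : nodeSum t c w = 0) (h1 : nodeSum t c z = 0) :
    nodeSqSum t (fun n => c n * ((α - β * t n) / (w - t n))) z =
      nodeSqSum t c z * ((α - β * z) / (w - z)) := by
  obtain ⟨C, -, hC⟩ := exists_weight_le ht hw
  obtain ⟨C', -, hC'⟩ := exists_weight_le ht hz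
  have hs1 := summable_div_sub hc hw hC
  have hs2 := summable_div_sub hc hz hC'
  have hs3 := summable_div_sub_sq hc hz hC'
  have key : ∀ n, c n * ((α - β * t n) / (w - t n)) / (z - t n) ^ 2 =
      (c n / (z - t n) ^ 2) * ((α - β * z) / (w - z)) -
        ((c n / (z - t n)) * ((α - β * w) / (w - z) ^ 2) -
          (c n / (w - t n)) * ((α - β * w) / (w - z) ^ 2)) := fun n => by
    have h1 := sub_ne_zero.2 (hw n)
    have h2 := sub_ne_zero.2 (hz n)
    have h3 := sub_ne_zero.2 hzw.symm
    field_simp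
    ring
  unfold nodeSum at h0 h1
  unfold nodeSqSum
  simp_rw [key]
  rw [(hs3.mul_right _).tsum_sub ((hs2.mul_right _).sub (hs1.mul_right _)),
    (hs2.mul_right _).tsum_sub (hs1.mul_right _), tsum_mul_right, tsum_mul_right, tsum_mul_right,
    h0, h1]
  ring

/-- The product `∏ⱼ (αⱼ - βⱼ z) / (wⱼ - z)` over a finite set. -/
def factorProd {κ : Type*} (α β w : κ → ℂ) (F : Finset κ) (z : ℂ) : ℂ :=
  ∏ j ∈ F, (α j - β j * z) / (w j - z)

section Products

variable {κ : Type*} {α β w : κ → ℂ} {F : Finset κ}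

include ht in
lemma exists_norm_factorProd_le (hw : ∀ j ∈ F, ∀ n, w j ≠ t n) :
    ∃ C : ℝ, ∀ n, ‖factorProd α β w F (t n)‖ ≤ C := by
  classical
  have : ∀ j, ∃ C : ℝ, j ∈ F → ∀ n, ‖(α j - β j * t n) / (w j - t n)‖ ≤ C := fun j => by
    by_cases hj : j ∈ F
    · obtain ⟨C, hC⟩ := exists_norm_factor_le ht (α j) (β j) (hw j hj)
      exact ⟨C, fun _ => hC⟩
    · exact ⟨0, fun h => absurd h hj⟩
  choose C hC using this
  refine ⟨∏ j ∈ F, C j, fun n => ?_⟩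
  rw [factorProd, norm_prod]
  exact Finset.prod_le_prod (fun _ _ => norm_nonneg _) fun j hj => hC j hj n

include ht hc in
lemma nodeSum_mul_factorProd (hinj : Set.InjOn w F) (hw : ∀ j ∈ F, ∀ n, w j ≠ t n)
    (h0 : ∀ j ∈ F, nodeSum t c (w j) = 0) (z : ℂ) (hz : ∀ n, z ≠ t n) (hzw : ∀ j ∈ F, z ≠ w j) :
    nodeSum t (fun n => c n * factorProd α β w F (t n)) z =
      nodeSum t c z * factorProd α β w F z := by
  classical
  induction F using Finset.induction_on generalizing z with
  | empty => simp [factorProd]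
  | insert j F hj ih =>
    have ih' := ih (hinj.mono (by simp)) (fun i hi => hw i (Finset.mem_insert_of_mem hi))
      (fun i hi => h0 i (Finset.mem_insert_of_mem hi))
    obtain ⟨C, hC⟩ := exists_norm_factorProd_le (α := α) (β := β) ht
      (fun i (hi : i ∈ F) => hw i (Finset.mem_insert_of_mem hi))
    have hj' := Finset.mem_insert_self j F
    -- The factors already inserted are regular at `w j`, as `w` is injective, so `w j` is still a
    -- zero and one more factor can be applied.
    have hwj : nodeSum t (fun n => c n * factorProd α β w F (t n)) (w j) = 0 := by
      rw [ih' _ (hw j hj') fun i hi h => ?_, h0 j hj', zero_mul]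
      have := hinj hj' (Finset.mem_insert_of_mem hi) h
      exact hj (this ▸ hi)
    have := nodeSum_mul_factor (α := α j) (β := β j) ht (summable_weight_mul hc hC) (hw j hj') hz
      (hzw j hj') hwj
    rw [ih' z hz fun i hi => hzw i (Finset.mem_insert_of_mem hi)] at this
    simp only [factorProd, Finset.prod_insert hj] at this ⊢
    rw [mul_comm (_ / _), ← mul_assoc, ← this]
    congr 1
    ext n
    ring

include ht hc in
lemma nodeSqSum_mul_factorProd (hinj : Set.InjOn w F) (hw : ∀ j ∈ F, ∀ n, w j ≠ t n)
    (h0 : ∀ j ∈ F, nodeSum t c (w j) = 0) (hz : ∀ n, z ≠ t n) (hzw : ∀ j ∈ F, z ≠ w j)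
    (hz0 : nodeSum t c z = 0) :
    nodeSqSum t (fun n => c n * factorProd α β w F (t n)) z =
      nodeSqSum t c z * factorProd α β w F z := by
  classical
  induction F using Finset.induction_on with
  | empty => simp [factorProd]
  | insert j F hj ih =>
    have hinj' := hinj.mono (Finset.coe_subset.2 (Finset.subset_insert j F))
    have hw' := fun i (hi : i ∈ F) => hw i (Finset.mem_insert_of_mem hi)
    have h0' := fun i (hi : i ∈ F) => h0 i (Finset.mem_insert_of_mem hi)
    have hzw' := fun i (hi : i ∈ F) => hzw i (Finset.mem_insert_of_mem hi)
    obtain ⟨C, hC⟩ := exists_norm_factorProd_le (α := α) (β := β) ht hw'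
    have hj' := Finset.mem_insert_self j F
    have hwj : nodeSum t (fun n => c n * factorProd α β w F (t n)) (w j) = 0 := by
      rw [nodeSum_mul_factorProd ht hc hinj' hw' h0' _ (hw j hj') fun i hi h => ?_, h0 j hj',
        zero_mul]
      have := hinj hj' (Finset.mem_insert_of_mem hi) h
      exact hj (this ▸ hi)
    have hz0' : nodeSum t (fun n => c n * factorProd α β w F (t n)) z = 0 := by
      rw [nodeSum_mul_factorProd ht hc hinj' hw' h0' _ hz hzw', hz0, zero_mul]
    have := nodeSqSum_mul_factor (α := α j) (β := β j) ht (summable_weight_mul hc hC) (hw j hj') hz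
      (hzw j hj') hwj hz0'
    rw [ih hinj' hw' h0' hzw'] at this
    simp only [factorProd, Finset.prod_insert hj] at this ⊢
    rw [mul_comm (_ / _), ← mul_assoc, ← this]
    congr 1
    ext n
    ring

-- Cancelling the zero at `w k` last leaves minus the derivative of the sum there, times the other
-- factors; so `w k` stays a zero exactly when it was multiple, provided these factors do not
-- vanish.
include ht hc in
lemma nodeSum_mul_factorProd_self (hinj : Set.InjOn w F) (hw : ∀ j ∈ F, ∀ n, w j ≠ t n)
    (h0 : ∀ j ∈ F, nodeSum t c (w j) = 0) [DecidableEq κ] {k : κ} (hk : k ∈ F) :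
    nodeSum t (fun n => c n * factorProd α β w F (t n)) (w k) =
      nodeSqSum t c (w k) * factorProd α β w (F.erase k) (w k) * (α k - β k * w k) := by
  have hinj' := hinj.mono (Finset.coe_subset.2 (F.erase_subset k))
  have hw' := fun i (hi : i ∈ F.erase k) => hw i (Finset.mem_of_mem_erase hi)
  have h0' := fun i (hi : i ∈ F.erase k) => h0 i (Finset.mem_of_mem_erase hi)
  have hne : ∀ i ∈ F.erase k, w k ≠ w i := fun i hi h =>
    Finset.ne_of_mem_erase hi (hinj hk (Finset.mem_of_mem_erase hi) h).symm
  obtain ⟨C, hC⟩ := exists_norm_factorProd_le (α := α) (β := β) ht hw'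
  have hwk : nodeSum t (fun n => c n * factorProd α β w (F.erase k) (t n)) (w k) = 0 := by
    rw [nodeSum_mul_factorProd ht hc hinj' hw' h0' _ (hw k hk) hne, h0 k hk, zero_mul]
  have := nodeSum_mul_factor_self (α := α k) (β := β k) ht (summable_weight_mul hc hC) (hw k hk)
    hwk
  rw [nodeSqSum_mul_factorProd ht hc hinj' hw' h0' (hw k hk) hne (h0 k hk)] at this
  rw [← this]
  congr 1
  ext n
  simp only [factorProd, ← Finset.mul_prod_erase F _ hk]
  ring

end Products

end NodeSums

/-! ### Moving infinitely many zeros -/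

section Perturbation

lemma exists_tendsto_prod_ne_zero {y : ℕ → ℂ} (h0 : ∀ i, y i ≠ 0)
    (hs : Summable fun i => ‖y i - 1‖) :
    ∃ l : ℂ, l ≠ 0 ∧ Tendsto (fun K => ∏ i ∈ Finset.range K, y i) atTop (𝓝 l) := by
  have h1 := tprod_one_add_ne_zero_of_summable (f := fun i => y i - 1) (by simpa using h0) hs
  have h2 := (multipliable_one_add_of_summable hs).hasProd.tendsto_prod_nat
  simp only [add_sub_cancel] at h1 h2
  exact ⟨_, h1, h2⟩

variable {ι : Type*} {t μ : ι → ℝ}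

/-- The coefficients `aₙ μₙ^{1/2}` of a Cauchy transform. -/
def coeffs (μ : ι → ℝ) (a : ι → ℂ) (n : ι) : ℂ := a n * (Real.sqrt (μ n) : ℂ)

lemma memℓp_sqrt_div (ht : Tendsto (fun n => |t n|) cofinite atTop) (hμ0 : ∀ n, 0 ≤ μ n)
    (hμ : Summable fun n => μ n / (1 + |t n|) ^ 2) {z : ℂ} (hz : ∀ n, z ≠ t n) :
    Memℓp (fun n => (Real.sqrt (μ n) : ℂ) / (z - t n)) 2 := by
  obtain ⟨C, hC0, hC⟩ := exists_weight_le ht hz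
  apply memℓp_gen
  refine Summable.of_nonneg_of_le (fun n => by positivity) (fun n => ?_) (hμ.mul_left (C ^ 2))
  have hpos : 0 < ‖z - t n‖ := norm_pos_iff.2 (sub_ne_zero.2 (hz n))
  have h1 : 0 < 1 + |t n| := by positivity
  simp only [ENNReal.toReal_ofNat, Real.rpow_ofNat, norm_div, div_pow, Complex.norm_real,
    Real.norm_eq_abs, sq_abs, Real.sq_sqrt (hμ0 n)]
  rw [div_le_iff₀ (by positivity), mul_div_assoc', div_mul_eq_mul_div, le_div_iff₀ (by positivity)]
  have := mul_le_mul (hC n) (hC n) h1.le (by positivity)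
  nlinarith [hμ0 n]

lemma summable_coeffs (hμ0 : ∀ n, 0 ≤ μ n)
    (hμ : Summable fun n => μ n / (1 + |t n|) ^ 2) (a : lp (fun _ : ι => ℂ) 2) :
    Summable fun n => ‖coeffs μ a n‖ / (1 + |t n|) := by
  have h2 := (lp.memℓp a).summable (by simp)
  simp only [ENNReal.toReal_ofNat, Real.rpow_ofNat] at h2
  refine Summable.of_nonneg_of_le (fun n => by positivity) (fun n => ?_) (h2.add hμ)
  have h1 : 0 < 1 + |t n| := by positivity
  have h3 : μ n / (1 + |t n|) ^ 2 = (Real.sqrt (μ n) / (1 + |t n|)) ^ 2 := by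
    rw [div_pow, Real.sq_sqrt (hμ0 n)]
  have h4 : ‖coeffs μ a n‖ / (1 + |t n|) = ‖a n‖ * (Real.sqrt (μ n) / (1 + |t n|)) := by
    rw [coeffs, norm_mul, Complex.norm_real, Real.norm_eq_abs, abs_of_nonneg (Real.sqrt_nonneg _),
      mul_div_assoc]
  rw [h3, h4]
  nlinarith [sq_nonneg (‖a n‖ - Real.sqrt (μ n) / (1 + |t n|)), sq_nonneg (‖a n‖),
    sq_nonneg (Real.sqrt (μ n) / (1 + |t n|))]

/-- Evaluation at `z` is the inner product with a fixed `ℓ²` vector, so zeros and values pass to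
`ℓ²` limits of coefficients. -/
lemma continuous_nodeSum_coeffs (ht : Tendsto (fun n => |t n|) cofinite atTop)
    (hμ0 : ∀ n, 0 ≤ μ n) (hμ : Summable fun n => μ n / (1 + |t n|) ^ 2) {z : ℂ}
    (hz : ∀ n, z ≠ t n) :
    Continuous fun a : lp (fun _ : ι => ℂ) 2 => nodeSum t (coeffs μ a) z := by
  let v : lp (fun _ : ι => ℂ) 2 := ⟨_, memℓp_sqrt_div ht hμ0 hμ hz⟩
  have : (fun a : lp (fun _ : ι => ℂ) 2 => nodeSum t (coeffs μ a) z) =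
      fun a => inner ℂ (star v) a := by
    ext a
    rw [lp.inner_eq_tsum, nodeSum]
    refine tsum_congr fun n => ?_
    rw [lp.star_apply]
    simp only [RCLike.inner_apply, RCLike.star_def, Complex.conj_conj, coeffs, v]
    ring
  rw [this]
  fun_prop

lemma memℓp_mul {a : ι → ℂ} (ha : Memℓp a 2) {b : ι → ℂ} {C : ℝ} (hb : ∀ n, ‖b n‖ ≤ C) :
    Memℓp (fun n => a n * b n) 2 := by
  refine (ha.const_mul (C : ℂ)).mono' fun n => ?_
  rw [norm_mul, norm_mul, mul_comm, Complex.norm_real]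
  gcongr
  exact (hb n).trans (le_abs_self C)

/-- A factor with `β = 0` is a constant over `w - t n` and gains one power of `1 + |t n|`; the
remaining factors are merely bounded. -/
lemma norm_factorProd_mul_weight_le (ht : Tendsto (fun n => |t n|) cofinite atTop)
    {α β w : ℕ → ℂ} (hw : ∀ j n, w j ≠ t n) {L : ℕ} (hβ : ∀ j < L, β j = 0) {F : Finset ℕ}
    (hF : Finset.range L ⊆ F) :
    ∃ C : ℝ, ∀ n, ‖factorProd α β w F (t n)‖ * (1 + |t n|) ^ L ≤ C := by
  obtain ⟨C, hC⟩ := exists_norm_factorProd_le (α := α) (β := β) (F := F \ Finset.range L) ht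
    fun j _ => hw j
  have : ∀ j, ∃ C : ℝ, j < L → ∀ n, ‖(α j - β j * t n) / (w j - t n)‖ * (1 + |t n|) ≤ C := by
    intro j
    obtain ⟨C, hC0, hC⟩ := exists_weight_le ht (hw j)
    refine ⟨‖α j‖ * C, fun hj n => ?_⟩
    have hpos : 0 < ‖w j - t n‖ := norm_pos_iff.2 (sub_ne_zero.2 (hw j n))
    rw [hβ j hj, zero_mul, sub_zero, norm_div, div_mul_eq_mul_div, div_le_iff₀ hpos]
    nlinarith [hC n, norm_nonneg (α j)]
  choose D hD using this
  refine ⟨C * ∏ j ∈ Finset.range L, D j, fun n => ?_⟩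
  rw [factorProd, ← Finset.prod_sdiff hF, norm_mul, mul_assoc]
  refine mul_le_mul (hC n) ?_ (by positivity) ((norm_nonneg _).trans (hC n))
  rw [norm_prod]
  calc (∏ j ∈ Finset.range L, ‖(α j - β j * t n) / (w j - t n)‖) * (1 + |t n|) ^ L
      = ∏ j ∈ Finset.range L, (‖(α j - β j * t n) / (w j - t n)‖ * (1 + |t n|)) := by
        rw [Finset.prod_mul_distrib, Finset.prod_const, Finset.card_range]
    _ ≤ _ := Finset.prod_le_prod (fun _ _ => by positivity) fun j hj =>
        hD j (Finset.mem_range.1 hj) n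

/-- Zeros `wⱼ` of a Cauchy transform together with points `uⱼ` to which they can be moved without
leaving the space, the move at the node `n j` costing at most a power of `t (n j)`. -/
structure ZeroMoves (t μ : ι → ℝ) (a : lp (fun _ : ι => ℂ) 2) (n : ℕ → ι) (w u : ℕ → ℂ)
    (C : ℝ) (L : ℕ) : Prop where
  w_off : ∀ j m, w j ≠ t m
  u_off : ∀ j m, u j ≠ t m
  w_ne_u : ∀ j k, w j ≠ u k
  u_ne_zero : ∀ j, u j ≠ 0
  w_ne_zero : ∀ j, w j ≠ 0
  injective : Function.Injective w
  tendsto_w : Tendsto (fun j => ‖w j‖) atTop atTop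
  tendsto_u : Tendsto (fun j => ‖u j‖) atTop atTop
  zero : ∀ j, nodeSum t (coeffs μ a) (w j) = 0
  far : ∀ j m, m ≠ n j → ‖u j - w j‖ ≤ ‖w j - t m‖
  near : ∀ j, ‖a (n j)‖ * ‖u j - w j‖ ≤ C * (1 + |t (n j)|) ^ L * ‖w j - t (n j)‖

namespace ZeroMoves

variable {a : lp (fun _ : ι => ℂ) 2} {n : ℕ → ι} {w u : ℕ → ℂ} {C : ℝ} {L : ℕ}

/-- The linear coefficient of the numerator of the `j`-th factor: the first `L + 1` zeros are
removed, and the others are moved to `u j`. -/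
def slope (L : ℕ) (w u : ℕ → ℂ) (j : ℕ) : ℂ := if j < L + 1 then 0 else w j / u j

/-- The coefficients after moving the zeros with index in `F`. -/
def moved (ht : Tendsto (fun n => |t n|) cofinite atTop) (h : ZeroMoves t μ a n w u C L)
    (F : Finset ℕ) : lp (fun _ : ι => ℂ) 2 :=
  ⟨fun m => a m * factorProd w (slope L w u) w F (t m),
    memℓp_mul (lp.memℓp a)
      (exists_norm_factorProd_le ht fun j (_ : j ∈ F) => h.w_off j).choose_spec⟩

variable (ht : Tendsto (fun n => |t n|) cofinite atTop) (h : ZeroMoves t μ a n w u C L)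

lemma moved_apply (F : Finset ℕ) (m : ι) :
    moved ht h F m = a m * factorProd w (slope L w u) w F (t m) := rfl

/-- Inserting `j` multiplies the `m`-th coefficient by `1 + t m * (u j - w j) / (u j * (w j - t
m))`. Away from the node `n j` the correction is at most `|t m| / ‖u j‖` by `far`; at that node
`near` costs a further `(1 + |t m|) ^ L`. The `L + 1` deleted zeros absorb both the power and the
extra `|t m|`, leaving a bound that tends to zero with `1 / ‖u j‖`. -/
lemma norm_moved_insert_sub_le (hC : 0 ≤ C) {F : Finset ℕ} (hF : Finset.range (L + 1) ⊆ F) :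
    ∃ D : ℝ, ∀ j ∉ F, ‖moved ht h (insert j F) - moved ht h F‖ ≤ D / ‖u j‖ := by
  classical
  obtain ⟨D, hD⟩ := norm_factorProd_mul_weight_le (α := w) (β := slope L w u) ht h.w_off
    (fun j hj => if_pos hj) hF
  refine ⟨D * (‖a‖ + C), fun j hj => ?_⟩
  have hjL : ¬ j < L + 1 := fun hlt => hj (hF (Finset.mem_range.2 hlt))
  have hu := h.u_ne_zero j
  have hupos : 0 < ‖u j‖ := norm_pos_iff.2 hu
  have hD0 : 0 ≤ D := le_trans (by positivity) (hD (n 0))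
  -- An `ℓ²` majorant: the `lp.single` term accounts for the exceptional node `n j`.
  let g : lp (fun _ : ι => ℝ) 2 := (D / ‖u j‖) • (lp.toNorm a + lp.single 2 (n j) C)
  have hg : ‖g‖ ≤ D * (‖a‖ + C) / ‖u j‖ := by
    rw [lp.norm_const_smul (by simp), Real.norm_eq_abs, abs_of_nonneg (by positivity),
      div_mul_eq_mul_div]
    gcongr
    refine (norm_add_le _ _).trans ?_
    rw [lp.norm_toNorm, lp.norm_single (by simp), Real.norm_eq_abs, abs_of_nonneg hC]
  refine le_trans (lp.norm_mono (by simp) fun m => ?_) hg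
  have hwm := sub_ne_zero.2 (h.w_off j m)
  have hwpos : 0 < ‖w j - t m‖ := norm_pos_iff.2 hwm
  have e1 : (moved ht h (insert j F) - moved ht h F) m =
      a m * factorProd w (slope L w u) w F (t m) * (t m * (u j - w j) / (u j * (w j - t m))) := by
    rw [lp.coeFn_sub, Pi.sub_apply, moved_apply, moved_apply]
    have : factorProd w (slope L w u) w (insert j F) (t m) =
      (w j - w j / u j * t m) / (w j - t m) * factorProd w (slope L w u) w F (t m) := by
      rw [factorProd, Finset.prod_insert hj, slope, if_neg hjL, factorProd]
    rw [this]
    field_simp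
    ring
  have e2 : g m = D / ‖u j‖ * (‖a m‖ + (lp.single 2 (n j) C : lp (fun _ : ι => ℝ) 2) m) := rfl
  have e3 : 0 ≤ (lp.single 2 (n j) C : lp (fun _ : ι => ℝ) 2) m := by
    by_cases hm : m = n j
    · subst hm; rw [lp.single_apply_self]; exact hC
    · rw [lp.single_apply_ne _ _ _ hm]
  have hΦ := norm_nonneg (factorProd w (slope L w u) w F (t m))
  set Φ := ‖factorProd w (slope L w u) w F (t m)‖ with hΦdef
  have h1 : (1 : ℝ) ≤ 1 + |t m| := by simp
  have htΦ : Φ * |t m| * (1 + |t m|) ^ L ≤ D := by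
    refine le_trans ?_ (hD m)
    rw [pow_succ', mul_assoc]
    gcongr
    linarith
  rw [e2, Real.norm_of_nonneg (by positivity), e1, norm_mul, norm_mul, norm_div, norm_mul, norm_mul,
    ← hΦdef, Complex.norm_real, Real.norm_eq_abs, div_mul_eq_mul_div, mul_div_assoc',
    div_le_div_iff₀ (by positivity) hupos]
  by_cases hm : m = n j
  · have hn := h.near j
    rw [← hm] at hn
    have hs : (lp.single 2 (n j) C : lp (fun _ : ι => ℝ) 2) m = C := by
      subst hm; rw [lp.single_apply_self]
    rw [hs]
    calc ‖a m‖ * Φ * (|t m| * ‖u j - w j‖) * ‖u j‖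
        = (‖a m‖ * ‖u j - w j‖) * (Φ * |t m| * ‖u j‖) := by ring
      _ ≤ (C * (1 + |t m|) ^ L * ‖w j - t m‖) * (Φ * |t m| * ‖u j‖) := by gcongr
      _ = (Φ * |t m| * (1 + |t m|) ^ L) * (C * (‖u j‖ * ‖w j - t m‖)) := by ring
      _ ≤ D * (C * (‖u j‖ * ‖w j - t m‖)) := by gcongr
      _ ≤ D * (‖a m‖ + C) * (‖u j‖ * ‖w j - t m‖) := by
        rw [← mul_assoc]
        gcongr
        simp
  · have hf := h.far j m hm
    have hΦD : Φ * |t m| ≤ D := by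
      refine le_trans ?_ htΦ
      exact le_mul_of_one_le_right (by positivity) (one_le_pow₀ h1)
    calc ‖a m‖ * Φ * (|t m| * ‖u j - w j‖) * ‖u j‖
        = (Φ * |t m|) * ‖a m‖ * (‖u j‖ * ‖u j - w j‖) := by ring
      _ ≤ D * ‖a m‖ * (‖u j‖ * ‖w j - t m‖) := by gcongr
      _ ≤ _ := by
        gcongr
        linarith

end ZeroMoves

end Perturbation

section PerturbationLimit

variable {ι : Type*} {t μ : ι → ℝ}

namespace ZeroMoves

variable {a : lp (fun _ : ι => ℂ) 2} {n : ℕ → ι} {w u : ℕ → ℂ} {C : ℝ} {L : ℕ}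

lemma coeffs_moved (ht : Tendsto (fun n => |t n|) cofinite atTop)
    (h : ZeroMoves t μ a n w u C L) (F : Finset ℕ) :
    coeffs μ (moved ht h F) =
      fun m => coeffs μ a m * factorProd w (slope L w u) w F (t m) := by
  ext m
  rw [coeffs, moved_apply, coeffs]
  ring

lemma factor_ne_zero (h : ZeroMoves t μ a n w u C L) {j : ℕ} {z : ℂ} (hw : z ≠ w j)
    (hu : z ≠ u j) : (w j - slope L w u j * z) / (w j - z) ≠ 0 := by
  refine div_ne_zero ?_ (sub_ne_zero.2 hw.symm)
  rw [slope]
  split_ifs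
  · simpa using h.w_ne_zero j
  · have h1 := h.u_ne_zero j
    have : w j - w j / u j * z = w j / u j * (u j - z) := by field_simp
    rw [this]
    exact mul_ne_zero (div_ne_zero (h.w_ne_zero j) h1) (sub_ne_zero.2 hu.symm)

/-- The factor minus one equals `z * (1 / w - 1 / u) * w / (w - z)`, which is geometrically small
when `w` and `u` grow at least like `2 ^ i`. -/
lemma summable_factor_sub_one (h : ZeroMoves t μ a n w u C L) {κ : ℕ → ℕ}
    (hκ : ∀ i, L + 1 ≤ κ i) (hw : ∀ i, (2 : ℝ) ^ i ≤ ‖w (κ i)‖) (hu : ∀ i, (2 : ℝ) ^ i ≤ ‖u (κ i)‖)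
    (z : ℂ) :
    Summable fun i => ‖(w (κ i) - slope L w u (κ i) * z) / (w (κ i) - z) - 1‖ := by
  have hg : Summable fun i : ℕ => 4 * ‖z‖ * (1 / 2 : ℝ) ^ i :=
    (summable_geometric_of_lt_one (by norm_num) (by norm_num)).mul_left _
  refine Summable.of_norm_bounded_eventually_nat hg ?_
  have hev : ∀ᶠ i : ℕ in atTop, 2 * ‖z‖ + 1 ≤ (2 : ℝ) ^ i :=
    (tendsto_pow_atTop_atTop_of_one_lt (by norm_num)).eventually_ge_atTop _
  filter_upwards [hev] with i hi
  have hwi := hw i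
  have hui := hu i
  have hw0 := h.w_ne_zero (κ i)
  have hu0 := h.u_ne_zero (κ i)
  have h1 : ‖w (κ i)‖ / 2 ≤ ‖w (κ i) - z‖ := by
    have := norm_sub_norm_le (w (κ i)) z
    linarith
  have hpos : (0 : ℝ) < 2 ^ i := by positivity
  have hwpos : 0 < ‖w (κ i)‖ := hpos.trans_le hwi
  have hne : w (κ i) - z ≠ 0 := norm_pos_iff.1 (by linarith)
  have e : (w (κ i) - slope L w u (κ i) * z) / (w (κ i) - z) - 1 =
      z * ((w (κ i))⁻¹ - (u (κ i))⁻¹) * (w (κ i) / (w (κ i) - z)) := by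
    rw [slope, if_neg (by have := hκ i; omega)]
    field_simp
    ring
  rw [norm_norm, e, norm_mul, norm_mul, norm_div]
  have h2 : ‖(w (κ i))⁻¹ - (u (κ i))⁻¹‖ ≤ 2 * (1 / 2 : ℝ) ^ i := by
    refine (norm_sub_le _ _).trans ?_
    rw [norm_inv, norm_inv, one_div, inv_pow]
    have := inv_anti₀ hpos hwi
    have := inv_anti₀ hpos hui
    linarith
  have h3 : ‖w (κ i)‖ / ‖w (κ i) - z‖ ≤ 2 := by
    rw [div_le_iff₀ (by linarith)]
    linarith
  calc ‖z‖ * ‖(w (κ i))⁻¹ - (u (κ i))⁻¹‖ * (‖w (κ i)‖ / ‖w (κ i) - z‖)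
      ≤ ‖z‖ * (2 * (1 / 2 : ℝ) ^ i) * 2 := by gcongr
    _ = _ := by ring

/-- Zeros are moved one at a time, each so far out that the coefficient vectors form a Cauchy
sequence in `ℓ²`. The infinite product converges to a nonzero number off the points `w` and `u`, so
no other zeros are created; multiplicities decide what remains at the moved points. -/
lemma exists_limit (ht : Tendsto (fun n => |t n|) cofinite atTop) (hμ0 : ∀ n, 0 ≤ μ n)
    (hμ : Summable fun n => μ n / (1 + |t n|) ^ 2) (hC : 0 ≤ C)
    (h : ZeroMoves t μ a n w u C L) :
    ∃ κ : ℕ → ℕ, Function.Injective κ ∧ ∃ b : lp (fun _ : ι => ℂ) 2,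
      (∀ m, a m ≠ 0 → b m ≠ 0) ∧
      (∀ z : ℂ, (∀ m, z ≠ t m) → (∀ j, z ≠ w j) → (∀ j, z ≠ u j) →
        nodeSum t (coeffs μ a) z ≠ 0 → nodeSum t (coeffs μ b) z ≠ 0) ∧
      (∀ i, nodeSqSum t (coeffs μ a) (w (κ i)) ≠ 0 → nodeSum t (coeffs μ b) (w (κ i)) ≠ 0) ∧
      (∀ i, nodeSqSum t (coeffs μ a) (w (κ i)) = 0 → nodeSum t (coeffs μ b) (w (κ i)) = 0) ∧
      ∀ i, nodeSum t (coeffs μ b) (u (κ i)) = 0 := by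
  classical
  have hsum := summable_coeffs (t := t) hμ0 hμ a
  -- The greedy choice serves two ends: small increments give convergence in `ℓ²`, growth of `w` and
  -- `u` gives convergence of the product.
  have hpick : ∀ F : Finset ℕ, ∃ j, Finset.range (L + 1) ⊆ F → j ∉ F ∧
      ‖moved ht h (insert j F) - moved ht h F‖ ≤ (1 / 2) ^ F.card ∧
      (2 : ℝ) ^ F.card ≤ ‖w j‖ ∧ (2 : ℝ) ^ F.card ≤ ‖u j‖ := by
    intro F
    by_cases hF : Finset.range (L + 1) ⊆ F
    · obtain ⟨D, hD⟩ := norm_moved_insert_sub_le ht h hC hF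
      have h1 : ∀ᶠ j in atTop, j ∉ F := by
        rw [← Nat.cofinite_eq_atTop]
        exact F.finite_toSet.compl_mem_cofinite
      have h2 : Tendsto (fun j => D / ‖u j‖) atTop (𝓝 0) := h.tendsto_u.const_div_atTop D
      obtain ⟨j, hj1, hj2, hj3, hj4⟩ := (h1.and ((h2.eventually_le_const
        (show (0 : ℝ) < (1 / 2) ^ F.card by positivity)).and
        ((h.tendsto_w.eventually_ge_atTop ((2 : ℝ) ^ F.card)).and
        (h.tendsto_u.eventually_ge_atTop ((2 : ℝ) ^ F.card))))).exists
      exact ⟨j, fun _ => ⟨hj1, (hD j hj1).trans hj2, hj3, hj4⟩⟩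
    · exact ⟨0, fun h' => absurd h' hF⟩
  choose pick hpick using hpick
  let S : ℕ → Finset ℕ := fun K =>
    Nat.rec (Finset.range (L + 1)) (fun _ F => insert (pick F) F) K
  have hS0 : S 0 = Finset.range (L + 1) := rfl
  have hS1 : ∀ K, S (K + 1) = insert (pick (S K)) (S K) := fun K => rfl
  have hSsub : ∀ K, Finset.range (L + 1) ⊆ S K := by
    intro K
    induction K with
    | zero => exact subset_rfl
    | succ K ih => rw [hS1]; exact ih.trans (Finset.subset_insert _ _)
  have hSmono : Monotone S := monotone_nat_of_le_succ fun K => by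
    rw [hS1]; exact Finset.subset_insert _ _
  let κ : ℕ → ℕ := fun K => pick (S K)
  have hκ := fun K => hpick (S K) (hSsub K)
  have hcard : ∀ K, K ≤ (S K).card := by
    intro K
    induction K with
    | zero => exact Nat.zero_le _
    | succ K ih => rw [hS1, Finset.card_insert_of_notMem (hκ K).1]; omega
  have hκmem : ∀ {i K}, i < K → κ i ∈ S K := fun {i K} hiK =>
    hSmono (Nat.succ_le_of_lt hiK) (by rw [Nat.succ_eq_add_one, hS1]; exact Finset.mem_insert_self _ _)
  have hκinj : Function.Injective κ := by
    have hne : ∀ i j, i < j → κ i ≠ κ j := fun i j hij heq => (hκ j).1 <| by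
      have := hκmem hij
      rwa [heq] at this
    intro i j heq
    rcases lt_trichotomy i j with hij | hij | hij
    · exact absurd heq (hne i j hij)
    · exact hij
    · exact absurd heq.symm (hne j i hij)
  have hκL : ∀ i, L + 1 ≤ κ i := fun i => by
    by_contra hlt
    exact (hκ i).1 (hSsub i (Finset.mem_range.2 (not_le.1 hlt)))
  have hprod : ∀ (g : ℕ → ℂ) (K : ℕ), ∏ j ∈ S K, g j =
      (∏ j ∈ Finset.range (L + 1), g j) * ∏ i ∈ Finset.range K, g (κ i) := by
    intro g K
    induction K with
    | zero => simp [hS0]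
    | succ K ih =>
      rw [hS1, Finset.prod_insert (hκ K).1, ih, Finset.prod_range_succ _ K, mul_comm, mul_assoc]
  have hwκ : ∀ i, (2 : ℝ) ^ i ≤ ‖w (κ i)‖ := fun i =>
    (pow_le_pow_right₀ (by norm_num) (hcard i)).trans (hκ i).2.2.1
  have huκ : ∀ i, (2 : ℝ) ^ i ≤ ‖u (κ i)‖ := fun i =>
    (pow_le_pow_right₀ (by norm_num) (hcard i)).trans (hκ i).2.2.2
  have hcauchy : CauchySeq fun K => moved ht h (S K) := by
    refine cauchySeq_of_le_geometric (1 / 2) 1 (by norm_num) fun K => ?_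
    rw [dist_comm, dist_eq_norm, one_mul, hS1]
    exact (hκ K).2.1.trans (pow_le_pow_of_le_one (by norm_num) (by norm_num) (hcard K))
  obtain ⟨b, hb⟩ := cauchySeq_tendsto_of_complete hcauchy
  have hbapp : ∀ m, Tendsto (fun K => moved ht h (S K) m) atTop (𝓝 (b m)) := fun m =>
    ((lp.lipschitzWith_one_eval 2 m).continuous.tendsto b).comp hb
  have hbz : ∀ z : ℂ, (∀ m, z ≠ t m) → Tendsto (fun K => nodeSum t (coeffs μ (moved ht h (S K))) z)
      atTop (𝓝 (nodeSum t (coeffs μ b) z)) := fun z hz =>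
    ((continuous_nodeSum_coeffs ht hμ0 hμ hz).tendsto b).comp hb
  -- the full product at a point that is neither a removed nor a new zero
  have hlim : ∀ z : ℂ, (∀ j, z ≠ w j) → (∀ j, z ≠ u j) → ∃ l : ℂ, l ≠ 0 ∧
      Tendsto (fun K => factorProd w (slope L w u) w (S K) z) atTop (𝓝 l) := by
    intro z hzw hzu
    have hf := fun j => h.factor_ne_zero (hzw j) (hzu j)
    obtain ⟨l, hl, hlt⟩ := exists_tendsto_prod_ne_zero (fun i => hf (κ i))
      (h.summable_factor_sub_one hκL hwκ huκ z)
    refine ⟨_, mul_ne_zero (Finset.prod_ne_zero_iff.2 fun j (_ : j ∈ Finset.range (L + 1)) => hf j) hl,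
      (hlt.const_mul _).congr fun K => ?_⟩
    rw [factorProd, hprod]
  have hself : ∀ i K, i < K → nodeSum t (coeffs μ (moved ht h (S K))) (w (κ i)) =
      nodeSqSum t (coeffs μ a) (w (κ i)) *
        factorProd w (slope L w u) w ((S K).erase (κ i)) (w (κ i)) *
        (w (κ i) - slope L w u (κ i) * w (κ i)) := fun i K hiK => by
    rw [coeffs_moved]
    exact nodeSum_mul_factorProd_self ht hsum h.injective.injOn (fun j _ => h.w_off j)
      (fun j _ => h.zero j) (hκmem hiK)
  refine ⟨κ, hκinj, b, fun m hm => ?_, fun z hz hzw hzu hne => ?_, fun i hi => ?_, fun i hi => ?_,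
    fun i => ?_⟩
  · obtain ⟨l, hl, hlt⟩ := hlim (t m) (fun j => (h.w_off j m).symm) fun j => (h.u_off j m).symm
    rw [tendsto_nhds_unique (hbapp m) (hlt.const_mul (a m))]
    exact mul_ne_zero hm hl
  · obtain ⟨l, hl, hlt⟩ := hlim z hzw hzu
    have h1 : ∀ K, nodeSum t (coeffs μ (moved ht h (S K))) z =
        nodeSum t (coeffs μ a) z * factorProd w (slope L w u) w (S K) z := fun K => by
      rw [coeffs_moved]
      exact nodeSum_mul_factorProd ht hsum h.injective.injOn (fun j _ => h.w_off j)
        (fun j _ => h.zero j) z hz fun j _ => hzw j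
    rw [tendsto_nhds_unique (hbz z hz) ((hlt.const_mul _).congr fun K => (h1 K).symm)]
    exact mul_ne_zero hne hl
  · set k := κ i with hk
    let f : ℕ → ℂ := fun j => (w j - slope L w u j * w k) / (w j - w k)
    -- The factor of index `k` is singular at `w k`; it is replaced by `1` here and accounted for
    -- separately through `hself`.
    let g : ℕ → ℂ := fun j => if j = k then 1 else f j
    have hg0 : ∀ j, g j ≠ 0 := fun j => by
      by_cases hj : j = k
      · simp [g, hj]
      · simpa only [g, if_neg hj] using
          h.factor_ne_zero (h.injective.ne (Ne.symm hj)) (h.w_ne_u k j)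
    obtain ⟨l, hl, hlt⟩ := exists_tendsto_prod_ne_zero (fun i => hg0 (κ i))
      (Summable.of_nonneg_of_le (fun _ => norm_nonneg _) (fun j => by
        by_cases hj : κ j = k
        · simp [g, hj]
        · simp only [g, if_neg hj, f, le_refl])
        (h.summable_factor_sub_one hκL hwκ huκ (w k)))
    have h1 : ∀ᶠ K in atTop, (∏ j ∈ Finset.range (L + 1), g j) *
        (∏ i ∈ Finset.range K, g (κ i)) =
        factorProd w (slope L w u) w ((S K).erase k) (w k) := by
      filter_upwards [eventually_gt_atTop i] with K hK
      rw [← hprod, ← Finset.mul_prod_erase _ _ (hκmem hK)]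
      simp only [← hk, g, if_true, one_mul, factorProd]
      exact Finset.prod_congr rfl fun j hj => if_neg (Finset.ne_of_mem_erase hj)
    have h2 := (((hlt.const_mul (∏ j ∈ Finset.range (L + 1), g j)).congr' h1).const_mul
      (nodeSqSum t (coeffs μ a) (w k))).mul_const (w k - slope L w u k * w k)
    have h3 := (hbz (w k) (h.w_off k)).congr' (f₂ := fun K => nodeSqSum t (coeffs μ a) (w k) *
        factorProd w (slope L w u) w ((S K).erase k) (w k) * (w k - slope L w u k * w k)) (by
      filter_upwards [eventually_gt_atTop i] with K hK using hself i K hK)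
    rw [tendsto_nhds_unique h3 h2]
    refine mul_ne_zero (mul_ne_zero hi (mul_ne_zero (Finset.prod_ne_zero_iff.2 fun j _ => hg0 j) hl))
      ?_
    rw [slope, if_neg (by have := hκL i; omega)]
    have hu0 := h.u_ne_zero k
    have : w k - w k / u k * w k = w k / u k * (u k - w k) := by field_simp
    rw [this]
    exact mul_ne_zero (div_ne_zero (h.w_ne_zero k) hu0) (sub_ne_zero.2 (h.w_ne_u k k).symm)
  · refine tendsto_nhds_unique (hbz _ (h.w_off _)) (tendsto_const_nhds.congr' ?_)
    filter_upwards [eventually_gt_atTop i] with K hK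
    rw [hself i K hK, hi, zero_mul, zero_mul]
  · refine tendsto_nhds_unique (hbz _ (h.u_off _)) (tendsto_const_nhds.congr' ?_)
    filter_upwards [eventually_gt_atTop i] with K hK
    rw [coeffs_moved, nodeSum_mul_factorProd ht hsum h.injective.injOn (fun j _ => h.w_off j)
        (fun j _ => h.zero j) _ (h.u_off _) fun j _ => (h.w_ne_u j _).symm, factorProd,
      Finset.prod_eq_zero (hκmem hK), mul_zero]
    rw [slope, if_neg (by have := hκL i; omega), div_mul_cancel₀ _ (h.u_ne_zero _), sub_self,
      zero_div]

end ZeroMoves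

end PerturbationLimit

/-! ### Coefficients are determined by the function -/

section Uniqueness

variable {ι : Type*} {t : ι → ℝ} {c : ι → ℂ}

/-- The coefficient is recovered as a residue: `y * I * f (t n + y * I)` tends to `c n` as `y`
decreases to `0`, with the terms at `y = 1` as dominating series. -/
lemma eq_zero_of_nodeSum_eq_zero (ht : Tendsto (fun n => |t n|) cofinite atTop)
    (hinj : Function.Injective t) (hc : Summable fun n => ‖c n‖ / (1 + |t n|))
    (h0 : ∀ z : ℂ, (∀ n, z ≠ t n) → nodeSum t c z = 0) (n : ι) : c n = 0 := by
  classical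
  have hoff : ∀ y : ℝ, y ≠ 0 → ∀ m, (t n : ℂ) + y * Complex.I ≠ t m := fun y hy m heq => by
    have := congrArg Complex.im heq
    simp at this
    exact hy this
  obtain ⟨C, -, hC⟩ := exists_weight_le ht (hoff 1 one_ne_zero)
  have hs := summable_div_sub hc (hoff 1 one_ne_zero) hC
  have hlim : Tendsto (fun y : ℝ => ∑' m, c m * (y * Complex.I) / (t n + y * Complex.I - t m))
      (𝓝[>] 0) (𝓝 (∑' m, if m = n then c n else 0)) := by
    refine tendsto_tsum_of_dominated_convergence hs.norm (fun m => ?_) ?_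
    · by_cases hm : m = n
      · subst hm
        simp only [if_true]
        refine tendsto_const_nhds.congr' ?_
        filter_upwards [self_mem_nhdsWithin] with y hy
        have hy' : (y : ℂ) ≠ 0 := by exact_mod_cast (ne_of_gt hy)
        have := Complex.I_ne_zero
        rw [add_sub_cancel_left]
        field_simp
      · simp only [if_neg hm]
        have hne : (t n : ℂ) - t m ≠ 0 := sub_ne_zero.2 fun h => hm (hinj (by exact_mod_cast h.symm))
        have : ContinuousAt (fun y : ℝ => c m * (y * Complex.I) / (t n + y * Complex.I - t m)) 0 := by
          refine ContinuousAt.div (by fun_prop) (by fun_prop) ?_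
          simpa using hne
        have h2 := this.tendsto
        simp only [Complex.ofReal_zero, zero_mul, mul_zero, zero_div] at h2
        exact h2.mono_left nhdsWithin_le_nhds
    · filter_upwards [Ioc_mem_nhdsGT (zero_lt_one (α := ℝ))] with y hy m
      have key : ∀ x : ℝ, ‖(t n : ℂ) + x * Complex.I - t m‖ = √((t n - t m) ^ 2 + x ^ 2) := by
        intro x
        rw [Complex.norm_eq_sqrt_sq_add_sq]
        simp
      have h1 : 0 < ‖(t n : ℂ) + y * Complex.I - t m‖ :=
        norm_pos_iff.2 (sub_ne_zero.2 (hoff y hy.1.ne' m))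
      have h2 : 0 < ‖(t n : ℂ) + (1 : ℝ) * Complex.I - t m‖ :=
        norm_pos_iff.2 (sub_ne_zero.2 (hoff 1 one_ne_zero m))
      rw [norm_div, norm_div, norm_mul, norm_mul, Complex.norm_I, Complex.norm_real,
        Real.norm_of_nonneg hy.1.le, mul_one, div_le_div_iff₀ h1 h2, mul_assoc]
      refine mul_le_mul_of_nonneg_left ?_ (norm_nonneg _)
      rw [key, key]
      refine Real.le_sqrt_of_sq_le ?_
      rw [mul_pow, Real.sq_sqrt (by positivity)]
      have : y ^ 2 ≤ 1 := pow_le_one₀ hy.1.le hy.2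
      nlinarith [sq_nonneg (t n - t m)]
  rw [tsum_ite_eq] at hlim
  refine tendsto_nhds_unique hlim (tendsto_const_nhds.congr' ?_)
  filter_upwards [self_mem_nhdsWithin] with y hy
  have := h0 _ (hoff y (ne_of_gt hy))
  rw [nodeSum] at this
  calc (0 : ℂ) = (∑' m, c m / (t n + y * Complex.I - t m)) * (y * Complex.I) := by
        rw [this, zero_mul]
    _ = _ := by
        rw [← tsum_mul_right]
        exact tsum_congr fun m => by ring

end Uniqueness

/-! ### Admissible data and the geometry of localizing disks -/

section Basic

variable {I : Set ℤ} {t μ : I → ℝ}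

lemma IsAdmissible.summable (h : IsAdmissible I t μ) :
    Summable fun n => μ n / (1 + |t n|) ^ 2 := by
  have h1 := h.integrable
  rw [discreteMeasure, integrable_sum_measure_iff] at h1
  have h2 := h1.2
  refine Summable.of_nonneg_of_le (fun n => div_nonneg (h.mass_pos n).le (by positivity))
    (fun n => ?_) h2
  rw [integral_smul_measure, integral_dirac, ENNReal.toReal_ofReal (h.mass_pos n).le, smul_eq_mul,
    Real.norm_of_nonneg (by positivity), mul_one_div]
  have := (h.mass_pos n).le
  gcongr
  nlinarith [abs_nonneg (t n), sq_abs (t n)]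

lemma mem_compl_nodeSet {z : ℂ} : z ∈ (nodeSet t)ᶜ ↔ ∀ n, z ≠ t n := by
  simp only [nodeSet, Set.mem_compl_iff, Set.mem_range, not_exists]
  exact forall_congr' fun n => ne_comm

lemma cauchyTransform_apply (a : lp (fun _ : I => ℂ) 2) (z : ((nodeSet t)ᶜ : Set ℂ)) :
    cauchyTransform t μ a z = nodeSum t (coeffs μ a) z := rfl

lemma IsAdmissible.coeffs_eq_zero (h : IsAdmissible I t μ) {a : lp (fun _ : I => ℂ) 2}
    (h0 : ∀ z : ℂ, (∀ n, z ≠ t n) → nodeSum t (coeffs μ a) z = 0) : a = 0 := by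
  ext n
  have := eq_zero_of_nodeSum_eq_zero h.tendsto_abs h.strictMono.injective
    (summable_coeffs (fun n => (h.mass_pos n).le) h.summable a) h0 n
  rw [coeffs, mul_eq_zero] at this
  refine this.resolve_right ?_
  exact_mod_cast (Real.sqrt_pos.2 (h.mass_pos n)).ne'

lemma IsAdmissible.cauchyTransform_injective (h : IsAdmissible I t μ) :
    Function.Injective (cauchyTransform t μ) := by
  intro a b hab
  rw [← sub_eq_zero]
  refine h.coeffs_eq_zero fun z hz => ?_
  have hμ0 := fun n => (h.mass_pos n).le
  obtain ⟨C, -, hC⟩ := exists_weight_le h.tendsto_abs hz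
  have h1 := summable_div_sub (summable_coeffs hμ0 h.summable a) hz hC
  have h2 := summable_div_sub (summable_coeffs hμ0 h.summable b) hz hC
  have h3 := congrFun hab ⟨z, mem_compl_nodeSet.2 hz⟩
  rw [cauchyTransform_apply, cauchyTransform_apply] at h3
  rw [← sub_eq_zero.2 h3, nodeSum, nodeSum, nodeSum, ← h1.tsum_sub h2]
  refine tsum_congr fun n => ?_
  rw [coeffs, lp.coeFn_sub, Pi.sub_apply, coeffs, coeffs]
  ring

lemma IsAdmissible.cauchyTransform_ne_zero (h : IsAdmissible I t μ) {a : lp (fun _ : I => ℂ) 2}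
    (ha : a ≠ 0) : cauchyTransform t μ a ≠ 0 := by
  intro h0
  exact ha (h.coeffs_eq_zero fun z hz => congrFun h0 ⟨z, mem_compl_nodeSet.2 hz⟩)

lemma IsAdmissible.mem_zeroSet (h : IsAdmissible I t μ) {a : lp (fun _ : I => ℂ) 2} {z : ℂ} :
    z ∈ zeroSet t μ (cauchyTransform t μ a) ↔
      ((∀ n, z ≠ t n) ∧ nodeSum t (coeffs μ a) z = 0) ∨ ∃ n, z = t n ∧ a n = 0 := by
  refine or_congr ⟨fun ⟨hz, h0⟩ => ⟨mem_compl_nodeSet.1 hz, h0⟩,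
    fun ⟨hz, h0⟩ => ⟨mem_compl_nodeSet.2 hz, h0⟩⟩ ⟨?_, fun ⟨n, hn⟩ => ⟨a, rfl, n, hn⟩⟩
  rintro ⟨b, hb, n, hn⟩
  exact ⟨n, by rwa [h.cauchyTransform_injective hb]⟩

/-- The radii `r` witness the strong localization property. -/
structure LocalizingRadii (t μ r : I → ℝ) : Prop where
  pos : ∀ n, 0 < r n
  disjoint : Pairwise fun n m : I =>
    Disjoint (Metric.ball (t n : ℂ) (r n)) (Metric.ball (t m : ℂ) (r m))
  finite : ∀ a : lp (fun _ : I => ℂ) 2, a ≠ 0 →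
    {n : I | ¬ ∃! w : ℂ, w ∈ zeroSet t μ (cauchyTransform t μ a) ∩
      Metric.ball (t n : ℂ) (r n)}.Finite

lemma IsAdmissible.strongLocalization_iff (h : IsAdmissible I t μ) :
    StrongLocalization t μ ↔ ∃ r, LocalizingRadii t μ r := by
  constructor
  · rintro ⟨r, hr, hd, hf⟩
    exact ⟨r, hr, hd, fun a ha => hf _ ⟨a, rfl⟩ (h.cauchyTransform_ne_zero ha)⟩
  · rintro ⟨r, hr, hd, hf⟩
    refine ⟨r, hr, hd, ?_⟩
    rintro _ ⟨a, rfl⟩ ha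
    refine hf a ?_
    rintro rfl
    refine ha (funext fun z => ?_)
    simp [cauchyTransform]

variable {r : I → ℝ}

lemma LocalizingRadii.add_le (hr : LocalizingRadii t μ r) {n m : I} (hnm : n ≠ m) :
    r n + r m ≤ |t n - t m| := by
  have := (disjoint_ball_ball_iff (hr.pos n) (hr.pos m)).1 (hr.disjoint hnm)
  rwa [Complex.dist_of_im_eq (by simp), Complex.ofReal_re, Complex.ofReal_re, Real.dist_eq] at this

lemma LocalizingRadii.notMem_closedBall (hr : LocalizingRadii t μ r) {n m : I} (hnm : n ≠ m)
    {z : ℂ} (hz : z ∈ Metric.ball (t n : ℂ) (r n)) : z ∉ Metric.closedBall (t m : ℂ) (r m) := by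
  intro hz'
  have h1 := hr.add_le hnm
  have h2 : dist (t n : ℂ) (t m : ℂ) = |t n - t m| := by
    rw [Complex.dist_of_im_eq (by simp), Complex.ofReal_re, Complex.ofReal_re, Real.dist_eq]
  have h3 := dist_triangle_left (t n : ℂ) (t m) z
  rw [Metric.mem_ball] at hz
  rw [Metric.mem_closedBall] at hz'
  linarith

lemma LocalizingRadii.ne_node_of_mem_closedBall (hr : LocalizingRadii t μ r) {n : I} {z : ℂ}
    (hz : z ∈ Metric.closedBall (t n : ℂ) (r n)) (hzn : z ≠ t n) (m : I) : z ≠ t m := by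
  rintro rfl
  by_cases hnm : m = n
  · subst hnm; exact hzn rfl
  · exact hr.notMem_closedBall hnm (Metric.mem_ball_self (hr.pos m)) hz

/-- A disk cannot reach past another node. One node beyond `|R|` on either side therefore shields
the region `‖z‖ ≤ R` from all disks farther out on that side. -/
lemma LocalizingRadii.finite_norm_le (h : IsAdmissible I t μ) (hr : LocalizingRadii t μ r)
    (R : ℝ) : {n : I | ∃ z ∈ Metric.closedBall (t n : ℂ) (r n), ‖z‖ ≤ R}.Finite := by
  have hnorm : ∀ n : I, ∀ z ∈ Metric.closedBall (t n : ℂ) (r n), |t n| - r n ≤ ‖z‖ := by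
    intro n z hz
    rw [Metric.mem_closedBall, dist_comm, dist_eq_norm] at hz
    have := norm_sub_norm_le (t n : ℂ) z
    rw [Complex.norm_real, Real.norm_eq_abs] at this
    linarith
  have h1 : ∃ P : ℝ, ∀ n, P < t n → ∀ z ∈ Metric.closedBall (t n : ℂ) (r n), R < ‖z‖ := by
    by_cases hp : ∃ p, |R| < t p
    · obtain ⟨p, hp⟩ := hp
      refine ⟨t p, fun n hn z hz => ?_⟩
      have h1 := hr.add_le (n := n) (m := p) (fun h => by rw [h] at hn; exact lt_irrefl _ hn)
      have h2 := hnorm n z hz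
      rw [abs_of_pos (sub_pos.2 hn)] at h1
      have := le_abs_self R
      have := le_abs_self (t n)
      have := hr.pos p
      linarith
    · push Not at hp
      exact ⟨|R|, fun n hn => absurd hn (not_lt.2 (hp n))⟩
  have h2 : ∃ Q : ℝ, ∀ n, t n < Q → ∀ z ∈ Metric.closedBall (t n : ℂ) (r n), R < ‖z‖ := by
    by_cases hp : ∃ p, t p < -|R|
    · obtain ⟨p, hp⟩ := hp
      refine ⟨t p, fun n hn z hz => ?_⟩
      have h1 := hr.add_le (n := n) (m := p) (fun h => by rw [h] at hn; exact lt_irrefl _ hn)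
      have h2 := hnorm n z hz
      rw [abs_of_neg (sub_neg.2 hn)] at h1
      have := le_abs_self R
      have := neg_le_abs (t n)
      have := hr.pos p
      linarith
    · push Not at hp
      exact ⟨-|R|, fun n hn => absurd hn (not_lt.2 (hp n))⟩
  obtain ⟨P, hP⟩ := h1
  obtain ⟨Q, hQ⟩ := h2
  have hfin : {n | ¬ max |P| |Q| < |t n|}.Finite := h.tendsto_abs.eventually_gt_atTop _
  refine hfin.subset fun n hn hlt => ?_
  obtain ⟨z, hz, hzR⟩ := hn
  rcases abs_cases (t n) with ⟨habs, -⟩ | ⟨habs, -⟩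
  · have : P < t n := by
      have := le_max_left |P| |Q|
      have := le_abs_self P
      linarith
    exact absurd hzR (not_le.2 (hP n this z hz))
  · have : t n < Q := by
      have := le_max_right |P| |Q|
      have := neg_le_abs Q
      linarith
    exact absurd hzR (not_le.2 (hQ n this z hz))

lemma LocalizingRadii.exists_radius_le (h : IsAdmissible I t μ) (hr : LocalizingRadii t μ r) :
    ∃ C : ℝ, 0 ≤ C ∧ ∀ n, r n ≤ C * (1 + |t n|) := by
  obtain ⟨p, hp⟩ := h.infinite.nonempty
  have hrp := hr.pos ⟨p, hp⟩
  refine ⟨1 + |t ⟨p, hp⟩| + r ⟨p, hp⟩, by positivity, fun n => ?_⟩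
  by_cases hn : n = ⟨p, hp⟩
  · subst hn
    nlinarith [abs_nonneg (t ⟨p, hp⟩)]
  · have h1 := hr.add_le hn
    have h2 := abs_sub (t n) (t ⟨p, hp⟩)
    nlinarith [abs_nonneg (t ⟨p, hp⟩), abs_nonneg (t n)]

end Basic

/-! ### Localized zeros cannot be moved -/

section Moves

variable {I : Set ℤ} {t μ r : I → ℝ}

lemma LocalizingRadii.exists_moved (h : IsAdmissible I t μ) (hr : LocalizingRadii t μ r)
    {a : lp (fun _ : I => ℂ) 2} {B : Set I} (hB : B.Infinite) {w u : I → ℂ} {C : ℝ} {L : ℕ}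
    (hC : 0 ≤ C) (hw : ∀ n ∈ B, w n ∈ Metric.ball (t n : ℂ) (r n)) (hwt : ∀ n ∈ B, w n ≠ t n)
    (hw0 : ∀ n ∈ B, nodeSum t (coeffs μ a) (w n) = 0)
    (hu : ∀ n ∈ B, u n ∈ Metric.closedBall (t n : ℂ) (r n)) (hut : ∀ n ∈ B, u n ≠ t n)
    (hwu : ∀ n ∈ B, w n ≠ u n)
    (hfar : ∀ n ∈ B, ∀ m, m ≠ n → ‖u n - w n‖ ≤ ‖w n - t m‖)
    (hnear : ∀ n ∈ B, ‖a n‖ * ‖u n - w n‖ ≤ C * (1 + |t n|) ^ L * ‖w n - t n‖) :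
    ∃ B' ⊆ B, B'.Infinite ∧ ∃ b : lp (fun _ : I => ℂ) 2,
      (∀ m, a m ≠ 0 → b m ≠ 0) ∧
      (∀ z : ℂ, (∀ m, z ≠ t m) → (∀ n ∈ B, z ≠ w n) → (∀ n ∈ B, z ≠ u n) →
        nodeSum t (coeffs μ a) z ≠ 0 → nodeSum t (coeffs μ b) z ≠ 0) ∧
      (∀ n ∈ B', nodeSqSum t (coeffs μ a) (w n) ≠ 0 → nodeSum t (coeffs μ b) (w n) ≠ 0) ∧
      (∀ n ∈ B', nodeSqSum t (coeffs μ a) (w n) = 0 → nodeSum t (coeffs μ b) (w n) = 0) ∧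
      ∀ n ∈ B', nodeSum t (coeffs μ b) (u n) = 0 := by
  -- Disks touching the origin are discarded because the factors divide by `u` and must not vanish
  -- with `w`.
  have hB0 : (B \ {n : I | ∃ z ∈ Metric.closedBall (t n : ℂ) (r n), ‖z‖ ≤ 0}).Infinite :=
    hB.sdiff (hr.finite_norm_le h 0)
  let e := hB0.natEmbedding
  let n : ℕ → I := fun j => e j
  have hn : ∀ j, n j ∈ B := fun j => (e j).2.1
  have hn0 : ∀ j, ∀ z ∈ Metric.closedBall (t (n j) : ℂ) (r (n j)), z ≠ 0 := fun j z hz hz0 =>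
    (e j).2.2 ⟨z, hz, by simp [hz0]⟩
  have hninj : Function.Injective n := Subtype.val_injective.comp e.injective
  have htend : ∀ v : I → ℂ, (∀ n ∈ B, v n ∈ Metric.closedBall (t n : ℂ) (r n)) →
      Tendsto (fun j => ‖v (n j)‖) atTop atTop := by
    intro v hv
    rw [← Nat.cofinite_eq_atTop, tendsto_atTop]
    intro R
    refine ((hr.finite_norm_le h R).preimage hninj.injOn).subset fun j hj => ?_
    exact ⟨v (n j), hv _ (hn j), (not_le.1 (show ¬ R ≤ ‖v (n j)‖ from hj)).le⟩
  have hwc : ∀ n ∈ B, w n ∈ Metric.closedBall (t n : ℂ) (r n) := fun n hnB =>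
    Metric.ball_subset_closedBall (hw n hnB)
  have hZ : ZeroMoves t μ a n (fun j => w (n j)) (fun j => u (n j)) C L :=
    { w_off := fun j => hr.ne_node_of_mem_closedBall (hwc _ (hn j)) (hwt _ (hn j))
      u_off := fun j => hr.ne_node_of_mem_closedBall (hu _ (hn j)) (hut _ (hn j))
      w_ne_u := fun j k => by
        by_cases hjk : j = k
        · subst hjk; exact hwu _ (hn j)
        · intro heq
          refine hr.notMem_closedBall (hninj.ne hjk) (hw _ (hn j)) ?_
          rw [heq]
          exact hu _ (hn k)
      u_ne_zero := fun j => hn0 j _ (hu _ (hn j))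
      w_ne_zero := fun j => hn0 j _ (hwc _ (hn j))
      injective := fun j k hjk => by
        by_contra hne
        refine hr.notMem_closedBall (hninj.ne hne) (hw _ (hn j)) ?_
        have : w (n j) = w (n k) := hjk
        rw [this]
        exact hwc _ (hn k)
      tendsto_w := htend w hwc
      tendsto_u := htend u hu
      zero := fun j => hw0 _ (hn j)
      far := fun j m hm => hfar _ (hn j) m hm
      near := fun j => hnear _ (hn j) }
  obtain ⟨κ, hκ, b, h1, h2, h3, h4, h5⟩ :=
    hZ.exists_limit h.tendsto_abs (fun n => (h.mass_pos n).le) h.summable hC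
  refine ⟨Set.range fun i => n (κ i), ?_, Set.infinite_range_of_injective (hninj.comp hκ), b, h1,
    fun z hz hzw hzu => h2 z hz (fun j => hzw _ (hn j)) fun j => hzu _ (hn j), ?_, ?_, ?_⟩
  · rintro _ ⟨i, rfl⟩; exact hn _
  · rintro _ ⟨i, rfl⟩; exact h3 i
  · rintro _ ⟨i, rfl⟩; exact h4 i
  · rintro _ ⟨i, rfl⟩; exact h5 i

lemma LocalizingRadii.node_dist_le (hr : LocalizingRadii t μ r) {n m : I} (hnm : m ≠ n) {w : ℂ}
    (_ : w ∈ Metric.ball (t n : ℂ) (r n)) : r n - ‖w - t n‖ ≤ ‖w - t m‖ := by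
  have h1 := hr.add_le hnm
  have h2 : ‖(t m : ℂ) - t n‖ = |t m - t n| := by
    rw [← Complex.ofReal_sub, Complex.norm_real, Real.norm_eq_abs]
  have h3 : ‖(t m : ℂ) - t n‖ ≤ ‖w - t n‖ + ‖w - t m‖ := by
    have := norm_sub_le (w - t n) (w - t m)
    rwa [sub_sub_sub_cancel_left] at this
  have := hr.pos m
  linarith

/-- Infinitely many zeros cannot be moved out of their disks, at the cost of a power of `|tₙ|`. -/
lemma LocalizingRadii.not_infinite_movable (h : IsAdmissible I t μ) (hr : LocalizingRadii t μ r)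
    {a : lp (fun _ : I => ℂ) 2} {B : Set I} (hB : B.Infinite) {w : I → ℂ} {C : ℝ} {L : ℕ}
    (hC : 0 ≤ C) (hw : ∀ n ∈ B, w n ∈ Metric.ball (t n : ℂ) (r n)) (hwt : ∀ n ∈ B, w n ≠ t n)
    (hw0 : ∀ n ∈ B, nodeSum t (coeffs μ a) (w n) = 0) (ha : ∀ n ∈ B, a n ≠ 0)
    (hbd : ∀ n ∈ B, ‖a n‖ * r n ≤ C * (1 + |t n|) ^ L * ‖w n - t n‖) : False := by
  obtain ⟨n₀, hn₀⟩ := hB.nonempty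
  have ne_zero : ∀ b : lp (fun _ : I => ℂ) 2, (∀ m, a m ≠ 0 → b m ≠ 0) → b ≠ 0 := by
    rintro _ hb rfl
    exact hb n₀ (ha n₀ hn₀) rfl
  have ha0 : a ≠ 0 := ne_zero a fun _ => id
  have hwpos : ∀ n ∈ B, 0 < ‖w n - t n‖ := fun n hn => norm_pos_iff.2 (sub_ne_zero.2 (hwt n hn))
  have hwr : ∀ n ∈ B, ‖w n - t n‖ < r n := fun n hn => by simpa [dist_eq_norm] using hw n hn
  have hB1 := hB.sdiff (hr.finite a ha0)
  set B1 := B \ {n : I | ¬ ∃! z : ℂ, z ∈ zeroSet t μ (cauchyTransform t μ a) ∩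
      Metric.ball (t n : ℂ) (r n)}
  have hoff : ∀ n ∈ B, ∀ m, w n ≠ t m := fun n hn =>
    hr.ne_node_of_mem_closedBall (Metric.ball_subset_closedBall (hw n hn)) (hwt n hn)
  have huniq : ∀ n ∈ B1, ∀ z ∈ Metric.ball (t n : ℂ) (r n), (∀ m, z ≠ t m) →
      nodeSum t (coeffs μ a) z = 0 → z = w n := by
    intro n hn z hz hzt hz0
    obtain ⟨v, -, hv⟩ := not_not.1 hn.2
    rw [hv z ⟨h.mem_zeroSet.2 (Or.inl ⟨hzt, hz0⟩), hz⟩,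
      hv (w n) ⟨h.mem_zeroSet.2 (Or.inl ⟨hoff n hn.1, hw0 n hn.1⟩), hw n hn.1⟩]
  by_cases hd : {n ∈ B1 | nodeSqSum t (coeffs μ a) (w n) = 0}.Infinite
  · -- double zeros are split inside the disk
    set Bd := {n ∈ B1 | nodeSqSum t (coeffs μ a) (w n) = 0}
    have hBd : ∀ n ∈ Bd, n ∈ B := fun n hn => hn.1.1
    -- Half of the minimum makes the shift shorter than both distances: the new zero stays in the
    -- disk and off the node, and the cost bounds hold with `C = ‖a‖` and `L = 0`.
    let ε : I → ℝ := fun n => min ‖w n - t n‖ (r n - ‖w n - t n‖) / 2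
    have hε : ∀ n ∈ Bd, 0 < ε n := fun n hn =>
      half_pos (lt_min (hwpos n (hBd n hn)) (sub_pos.2 (hwr n (hBd n hn))))
    have hε1 : ∀ n ∈ Bd, ε n < ‖w n - t n‖ := fun n hn =>
      (half_lt_self (by have := hε n hn; simp only [ε] at this; linarith)).trans_le (min_le_left _ _)
    have hε2 : ∀ n ∈ Bd, ε n < r n - ‖w n - t n‖ := fun n hn =>
      (half_lt_self (by have := hε n hn; simp only [ε] at this; linarith)).trans_le (min_le_right _ _)
    let u : I → ℂ := fun n => w n + (ε n : ℂ)
    have huw : ∀ n ∈ Bd, ‖u n - w n‖ = ε n := fun n hn => by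
      simp only [u, add_sub_cancel_left, Complex.norm_real]
      exact Real.norm_of_nonneg (hε n hn).le
    have hub : ∀ n ∈ Bd, u n ∈ Metric.ball (t n : ℂ) (r n) := fun n hn => by
      rw [Metric.mem_ball, dist_eq_norm]
      have h1 := norm_add_le (u n - w n) (w n - t n)
      rw [sub_add_sub_cancel, huw n hn] at h1
      have := hε2 n hn
      linarith
    have hwu : ∀ n ∈ Bd, w n ≠ u n := fun n hn heq => by
      have := huw n hn
      rw [heq, sub_self, norm_zero] at this
      exact (hε n hn).ne this
    have hut : ∀ n ∈ Bd, u n ≠ t n := fun n hn heq => by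
      have := huw n hn
      rw [heq, norm_sub_rev] at this
      exact (hε1 n hn).ne' this
    obtain ⟨B', hB'sub, hB', b, hb1, -, -, hb4, hb5⟩ := hr.exists_moved (a := a) h hd (u := u)
      (C := ‖a‖) (L := 0) (norm_nonneg _) (fun n hn => hw n (hBd n hn))
      (fun n hn => hwt n (hBd n hn)) (fun n hn => hw0 n (hBd n hn))
      (fun n hn => Metric.ball_subset_closedBall (hub n hn)) hut hwu
      (fun n hn m hm => by
        rw [huw n hn]
        exact (hε2 n hn).le.trans (hr.node_dist_le hm (hw n (hBd n hn))))
      (fun n hn => by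
        rw [huw n hn, pow_zero, mul_one]
        exact mul_le_mul (lp.norm_apply_le_norm (by simp) a n) (hε1 n hn).le (hε n hn).le
          (norm_nonneg _))
    obtain ⟨n, hn, hnu⟩ := (hB'.sdiff (hr.finite b (ne_zero b hb1))).nonempty
    obtain ⟨v, -, hv⟩ := not_not.1 hnu
    have hnd := hB'sub hn
    have hv1 := hv (w n) ⟨h.mem_zeroSet.2 (Or.inl ⟨hoff n (hBd n hnd), hb4 n hn hnd.2⟩),
      hw n (hBd n hnd)⟩
    have hv2 := hv (u n) ⟨h.mem_zeroSet.2 (Or.inl ⟨hr.ne_node_of_mem_closedBall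
      (Metric.ball_subset_closedBall (hub n hnd)) (hut n hnd), hb5 n hn⟩), hub n hnd⟩
    exact hwu n hnd (hv1.trans hv2.symm)
  · -- simple zeros are moved to the boundary of the disk
    have hB2 := hB1.sdiff (Set.not_infinite.1 hd)
    set B2 := B1 \ {n ∈ B1 | nodeSqSum t (coeffs μ a) (w n) = 0}
    have hB2B : ∀ n ∈ B2, n ∈ B := fun n hn => hn.1.1
    have hsq : ∀ n ∈ B2, nodeSqSum t (coeffs μ a) (w n) ≠ 0 := fun n hn h0 => hn.2 ⟨hn.1, h0⟩
    -- Radial projection onto the boundary circle: `u n` leaves its own open disk, yet lies in the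
    -- closed disk and hence in no other open one.
    let u : I → ℂ := fun n => t n + ((r n / ‖w n - t n‖ : ℝ) : ℂ) * (w n - t n)
    have hut' : ∀ n ∈ B2, ‖u n - t n‖ = r n := fun n hn => by
      have h1 := hwpos n (hB2B n hn)
      simp only [u, add_sub_cancel_left, norm_mul, Complex.norm_real, norm_div, norm_norm]
      rw [Real.norm_of_nonneg (hr.pos n).le, div_mul_cancel₀ _ h1.ne']
    have huw : ∀ n ∈ B2, ‖u n - w n‖ = r n - ‖w n - t n‖ := fun n hn => by
      have h1 := hwpos n (hB2B n hn)
      have h2 := hwr n (hB2B n hn)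
      have e : u n - w n = ((r n / ‖w n - t n‖ - 1 : ℝ) : ℂ) * (w n - t n) := by
        simp only [u]
        push_cast
        ring
      rw [e, norm_mul, Complex.norm_real, Real.norm_of_nonneg, sub_mul, div_mul_cancel₀ _ h1.ne',
        one_mul]
      rw [sub_nonneg, one_le_div h1]
      exact h2.le
    have hwu : ∀ n ∈ B2, w n ≠ u n := fun n hn heq => by
      have := huw n hn
      rw [heq, sub_self, norm_zero, ← heq] at this
      linarith [hwr n (hB2B n hn)]
    have hnb : ∀ n ∈ B2, u n ∉ Metric.ball (t n : ℂ) (r n) := fun n hn hub => by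
      rw [Metric.mem_ball, dist_eq_norm, hut' n hn] at hub
      exact lt_irrefl _ hub
    have hub : ∀ n ∈ B2, u n ∈ Metric.closedBall (t n : ℂ) (r n) := fun n hn => by
      rw [Metric.mem_closedBall, dist_eq_norm, hut' n hn]
    obtain ⟨B', hB'sub, hB', b, hb1, hb2, hb3, -, -⟩ := hr.exists_moved (a := a) h hB2 (u := u)
      (C := C) (L := L) hC (fun n hn => hw n (hB2B n hn))
      (fun n hn => hwt n (hB2B n hn)) (fun n hn => hw0 n (hB2B n hn)) hub
      (fun n hn heq => by
        have := hut' n hn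
        rw [heq, sub_self, norm_zero] at this
        exact (hr.pos n).ne this) hwu
      (fun n hn m hm => by
        rw [huw n hn]
        exact hr.node_dist_le hm (hw n (hB2B n hn)))
      (fun n hn => by
        refine le_trans ?_ (hbd n (hB2B n hn))
        rw [huw n hn]
        have := hwpos n (hB2B n hn)
        gcongr
        linarith)
    obtain ⟨n, hn, hnu⟩ := (hB'.sdiff (hr.finite b (ne_zero b hb1))).nonempty
    obtain ⟨v, ⟨hv, hvb⟩, -⟩ := not_not.1 hnu
    have hn2 := hB'sub hn
    -- The disk now contains no point of the zero set: the simple zero has gone, uniqueness rules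
    -- out a second old one, all new zeros lie outside, and the coefficient at the node is still
    -- nonzero.
    rcases h.mem_zeroSet.1 hv with ⟨hvt, hv0⟩ | ⟨m, hvm, hbm⟩
    · by_cases hvw : v = w n
      · rw [hvw] at hv0
        exact hb3 n hn (hsq n hn2) hv0
      · refine hb2 v hvt (fun k hk heq => ?_) (fun k hk heq => ?_)
          (fun h0 => hvw (huniq n hn2.1 v hvb hvt h0)) hv0
        · by_cases hkn : k = n
          · subst hkn; exact hvw heq
          · refine hr.notMem_closedBall (Ne.symm hkn) hvb ?_
            rw [heq]
            exact Metric.ball_subset_closedBall (hw k (hB2B k hk))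
        · by_cases hkn : k = n
          · subst hkn
            rw [heq] at hvb
            exact hnb k hk hvb
          · refine hr.notMem_closedBall (Ne.symm hkn) hvb ?_
            rw [heq]
            exact hub k hk
    · by_cases hmn : m = n
      · subst hmn
        exact hb1 m (ha m (hB2B m hn2)) hbm
      · refine hr.notMem_closedBall (Ne.symm hmn) hvb ?_
        rw [hvm]
        exact Metric.mem_closedBall_self (hr.pos m).le

/-- Zeros of Cauchy transforms are closer to the nodes than any power of `|tₙ|`. -/
lemma LocalizingRadii.finite_not_close (h : IsAdmissible I t μ) (hr : LocalizingRadii t μ r)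
    {a : lp (fun _ : I => ℂ) 2} (ha : a ≠ 0) {ε : ℝ} (hε : 0 < ε) (M : ℕ) :
    {n : I | a n ≠ 0 ∧ ¬ ∃ w : ℂ, w ∈ Metric.ball (t n : ℂ) (r n) ∧ w ≠ t n ∧
      nodeSum t (coeffs μ a) w = 0 ∧ ‖w - t n‖ * (1 + |t n|) ^ M < ε}.Finite := by
  by_contra hinf
  have hB := (Set.not_finite.1 hinf).sdiff (hr.finite a ha)
  obtain ⟨D, hD0, hD⟩ := hr.exists_radius_le h
  have hex : ∀ n : I, ∃ w : ℂ, n ∈ {n : I | a n ≠ 0 ∧ ¬ ∃ w : ℂ,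
      w ∈ Metric.ball (t n : ℂ) (r n) ∧ w ≠ t n ∧
      nodeSum t (coeffs μ a) w = 0 ∧ ‖w - t n‖ * (1 + |t n|) ^ M < ε} \
      {n : I | ¬ ∃! w : ℂ, w ∈ zeroSet t μ (cauchyTransform t μ a) ∩
      Metric.ball (t n : ℂ) (r n)} →
      w ∈ Metric.ball (t n : ℂ) (r n) ∧ w ≠ t n ∧ nodeSum t (coeffs μ a) w = 0 := by
    intro n
    by_cases hn : ∃! w : ℂ, w ∈ zeroSet t μ (cauchyTransform t μ a) ∩ Metric.ball (t n : ℂ) (r n)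
    · obtain ⟨w, ⟨hw, hwb⟩, -⟩ := hn
      refine ⟨w, fun hn' => ⟨hwb, ?_⟩⟩
      rcases h.mem_zeroSet.1 hw with ⟨hvt, hv0⟩ | ⟨m, hvm, hbm⟩
      · exact ⟨hvt n, hv0⟩
      · exfalso
        by_cases hmn : m = n
        · subst hmn
          exact hn'.1.1 hbm
        · refine hr.notMem_closedBall (Ne.symm hmn) hwb ?_
          rw [hvm]
          exact Metric.mem_closedBall_self (hr.pos m).le
    · exact ⟨0, fun hn' => absurd hn hn'.2⟩
  choose w hw using hex
  -- If the zeros stay at distance at least `ε * (1 + |t n|) ^ (-M)`, the bound `r n ≤ D * (1 + |t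
  -- n|)` makes them movable at the cost of the power `M + 1`.
  refine hr.not_infinite_movable (a := a) h hB (w := w) (C := ‖a‖ * D / ε) (L := M + 1)
    (by positivity) (fun n hn => (hw n hn).1) (fun n hn => (hw n hn).2.1)
    (fun n hn => (hw n hn).2.2) (fun n hn => hn.1.1) fun n hn => ?_
  have h1 : ε ≤ ‖w n - t n‖ * (1 + |t n|) ^ M := by
    by_contra hlt
    exact hn.1.2 ⟨w n, (hw n hn).1, (hw n hn).2.1, (hw n hn).2.2, not_le.1 hlt⟩
  calc ‖a n‖ * r n ≤ ‖a‖ * (D * (1 + |t n|)) :=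
        mul_le_mul (lp.norm_apply_le_norm (by simp) a n) (hD n) (hr.pos n).le (norm_nonneg _)
    _ = ‖a‖ * D * (1 + |t n|) / ε * ε := by field_simp
    _ ≤ ‖a‖ * D * (1 + |t n|) / ε * (‖w n - t n‖ * (1 + |t n|) ^ M) := by gcongr
    _ = _ := by ring

end Moves

/-! ### Power separation and decay of the masses -/

section Separation

variable {I : Set ℤ} {t μ r : I → ℝ}

lemma IsAdmissible.exists_separation (h : IsAdmissible I t μ) (hsep : IsPowerSeparated t) :
    ∃ δ : ℝ, 0 < δ ∧ δ ≤ 1 ∧ ∃ N : ℕ, ∀ n m, n ≠ m → δ ≤ |t n - t m| * (1 + |t n|) ^ N := by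
  obtain ⟨C, hC, N, hN⟩ := hsep
  have hstep : ∀ n m : I, (m : ℤ) = n + 1 → C ≤ (t m - t n) * |t n| ^ N := by
    intro n m hnm
    have h1 := hN n m hnm
    have hlt : n < m := Subtype.coe_lt_coe.1 (by omega)
    have hpos : 0 < |t n| ^ N := pow_pos (abs_pos.2 (h.ne_zero n)) N
    rwa [abs_of_pos (sub_pos.2 (h.strictMono hlt)), zpow_neg, zpow_natCast, ← div_eq_mul_inv,
      div_le_iff₀ hpos] at h1
  refine ⟨min C 1, lt_min hC one_pos, min_le_right _ _, N, fun n m hnm => ?_⟩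
  have h1 : (1 : ℝ) ≤ 1 + |t n| := by simp
  rcases lt_or_gt_of_ne hnm with hlt | hlt
  · have hlt' : (n : ℤ) < m := hlt
    let n' : I := ⟨n + 1, h.ordConnected.out n.2 m.2 ⟨by omega, by omega⟩⟩
    have h2 := hstep n n' rfl
    have h3 : t n' ≤ t m := h.strictMono.monotone (Subtype.coe_le_coe.1 (by
      change (n : ℤ) + 1 ≤ m; omega))
    have h4 : t n < t n' := h.strictMono (Subtype.coe_lt_coe.1 (by
      change (n : ℤ) < n + 1; omega))
    rw [abs_sub_comm, abs_of_pos (by linarith)]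
    refine (min_le_left _ _).trans (h2.trans ?_)
    have : |t n| ^ N ≤ (1 + |t n|) ^ N := by gcongr; linarith
    exact mul_le_mul (by linarith) this (by positivity) (by linarith)
  · have hlt' : (m : ℤ) < n := hlt
    let n' : I := ⟨n - 1, h.ordConnected.out m.2 n.2 ⟨by omega, by omega⟩⟩
    have h2 := hstep n' n (by change (n : ℤ) = n - 1 + 1; omega)
    have h3 : t m ≤ t n' := h.strictMono.monotone (Subtype.coe_le_coe.1 (by
      change (m : ℤ) ≤ n - 1; omega))
    have h4 : t n' < t n := h.strictMono (Subtype.coe_lt_coe.1 (by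
      change (n : ℤ) - 1 < n; omega))
    rw [abs_of_pos (by linarith)]
    by_cases h5 : 1 ≤ t n - t n'
    · refine (min_le_right _ _).trans ?_
      have := one_le_pow₀ h1 (n := N)
      nlinarith
    · refine (min_le_left _ _).trans (h2.trans ?_)
      have h6 : |t n'| ≤ 1 + |t n| := by
        have h7 := abs_sub_abs_le_abs_sub (t n') (t n)
        rw [abs_sub_comm, abs_of_pos (show 0 < t n - t n' by linarith)] at h7
        linarith
      have : |t n'| ^ N ≤ (1 + |t n|) ^ N := by gcongr
      exact mul_le_mul (by linarith) this (by positivity) (by linarith)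

variable {δ : ℝ} {N : ℕ}

/-- Disjoint intervals about the nodes, of length `δ / (1 + |t n|) ^ N`, share the finite integral
of `1 / (1 + x ^ 2)`, which is comparable to `(1 + |t n|) ^ (-2)` from below on each of them. -/
lemma summable_inv_weight (hδ : 0 < δ) (hδ1 : δ ≤ 1)
    (hsep : ∀ n m, n ≠ m → δ ≤ |t n - t m| * (1 + |t n|) ^ N) :
    Summable fun n => ((1 + |t n|) ^ (N + 2))⁻¹ := by
  let ρ : I → ℝ := fun n => δ / 2 / (1 + |t n|) ^ N
  have hρ0 : ∀ n, 0 < ρ n := fun n => by positivity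
  have hρ1 : ∀ n, ρ n ≤ 1 := fun n => by
    refine (div_le_self (by positivity) (one_le_pow₀ (by simp))).trans ?_
    linarith
  have hρ : ∀ n m, n ≠ m → 2 * ρ n ≤ |t n - t m| := fun n m hnm => by
    have := hsep n m hnm
    rw [show 2 * ρ n = δ / (1 + |t n|) ^ N by simp only [ρ]; ring, div_le_iff₀ (by positivity)]
    exact this
  have hdisj : Pairwise (Function.onFun Disjoint fun n => Set.Ioo (t n - ρ n) (t n + ρ n)) := by
    intro n m hnm
    refine Set.disjoint_left.2 fun x hx hx' => ?_
    have h1 := hρ n m hnm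
    have h2 := hρ m n hnm.symm
    rw [abs_sub_comm] at h2
    have h3 : |t n - t m| < ρ n + ρ m := by
      rw [abs_lt]
      constructor <;> linarith [hx.1, hx.2, hx'.1, hx'.2]
    linarith
  have hs := (hasSum_integral_iUnion (μ := volume) (f := fun x : ℝ => (1 + x ^ 2)⁻¹)
    (fun n => measurableSet_Ioo) hdisj integrable_inv_one_add_sq.integrableOn).summable
  refine Summable.of_nonneg_of_le (fun n => by positivity) (fun n => ?_) (hs.mul_left (2 / δ))
  have h1 : ∫ x in Set.Ioo (t n - ρ n) (t n + ρ n), (2 * (1 + |t n|) ^ 2)⁻¹ ≤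
      ∫ x in Set.Ioo (t n - ρ n) (t n + ρ n), (1 + x ^ 2)⁻¹ := by
    refine setIntegral_mono_on (integrableOn_const (by simp))
      integrable_inv_one_add_sq.integrableOn measurableSet_Ioo fun x hx => ?_
    refine inv_anti₀ (by positivity) ?_
    have h2 : |x| ≤ |t n| + 1 := by
      have h3 := abs_sub_abs_le_abs_sub x (t n)
      have h4 : |x - t n| ≤ 1 := by
        rw [abs_le]
        constructor <;> linarith [hx.1, hx.2, hρ1 n]
      linarith
    have h5 : x ^ 2 ≤ (|t n| + 1) ^ 2 := by
      rw [← sq_abs x]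
      gcongr
    nlinarith [abs_nonneg (t n)]
  rw [setIntegral_const, smul_eq_mul, Real.volume_real_Ioo_of_le (by linarith [hρ0 n])] at h1
  have h3 : (0 : ℝ) < 1 + |t n| := by positivity
  calc ((1 + |t n|) ^ (N + 2))⁻¹
      = 2 / δ * ((t n + ρ n - (t n - ρ n)) * (2 * (1 + |t n|) ^ 2)⁻¹) := by
        simp only [ρ]
        field_simp
        ring
    _ ≤ _ := by gcongr

lemma IsAdmissible.exists_nonvanishing (h : IsAdmissible I t μ) :
    ∃ a : lp (fun _ : I => ℂ) 2, ∀ n, a n ≠ 0 := by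
  refine ⟨⟨fun n => (Real.sqrt (μ n) / (1 + |t n|) : ℝ), memℓp_gen ?_⟩, fun n => ?_⟩
  · refine h.summable.congr fun n => ?_
    rw [ENNReal.toReal_ofNat, Real.rpow_ofNat, Complex.norm_real, Real.norm_eq_abs, sq_abs,
      div_pow, Real.sq_sqrt (h.mass_pos n).le]
  · have := Real.sqrt_pos.2 (h.mass_pos n)
    exact Complex.ofReal_ne_zero.2 (by positivity)

/-- At a zero the `n`-th term is minus the sum of the others. Since `w` is closer to `t n` than half
the separation, `‖w - t m‖ ≥ |t n - t m| / 2` for every other node. -/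
lemma norm_div_sub_le_of_nodeSum_eq_zero {c : I → ℂ} (hc : Summable fun n => ‖c n‖ / (1 + |t n|))
    (ht : Tendsto (fun n => |t n|) cofinite atTop) (hδ : 0 < δ)
    (hsep : ∀ n m, n ≠ m → δ ≤ |t n - t m| * (1 + |t n|) ^ N) {n : I} {w : ℂ}
    (hw : ∀ m, w ≠ t m) (h0 : nodeSum t c w = 0) (hclose : ‖w - t n‖ * (1 + |t n|) ^ N < δ / 2) :
    ‖c n / (w - t n)‖ ≤
      2 * (1 + 1 / δ) * (1 + |t n|) ^ (N + 1) * ∑' m, ‖c m‖ / (1 + |t m|) := by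
  classical
  obtain ⟨C, -, hC⟩ := exists_weight_le ht hw
  have hs := summable_div_sub hc hw hC
  have h1 := hs.tsum_eq_add_tsum_ite n
  rw [show ∑' m, c m / (w - t m) = 0 from h0] at h1
  have h2 : c n / (w - t n) = -∑' m, if m = n then 0 else c m / (w - t m) := by
    linear_combination -h1
  rw [h2, norm_neg]
  refine tsum_of_norm_bounded (hc.hasSum.mul_left _) fun m => ?_
  have hp : (0 : ℝ) < 1 + |t n| := by positivity
  split_ifs with hmn
  · rw [norm_zero]; positivity
  · have hd := hsep n m (Ne.symm hmn)
    have hpow : (0 : ℝ) < (1 + |t n|) ^ N := by positivity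
    have h3 : |t n - t m| ≤ 2 * ‖w - t m‖ := by
      have h4 : |t n - t m| ≤ ‖w - t n‖ + ‖w - t m‖ := by
        have := norm_sub_le (w - t m) (w - t n)
        rw [sub_sub_sub_cancel_left, ← Complex.ofReal_sub, Complex.norm_real,
          Real.norm_eq_abs] at this
        linarith
      have h5 : ‖w - t n‖ ≤ |t n - t m| / 2 := by
        refine le_of_mul_le_mul_right ?_ hpow
        linarith
      linarith
    have h6 : 1 + |t m| ≤ (1 + 1 / δ) * (1 + |t n|) ^ (N + 1) * |t n - t m| := by
      have h7 : |t m| ≤ |t n| + |t n - t m| := by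
        have := abs_sub_abs_le_abs_sub (t m) (t n)
        rw [abs_sub_comm] at this
        linarith
      have h8 : 1 + |t n| ≤ 1 / δ * (1 + |t n|) ^ (N + 1) * |t n - t m| := by
        rw [pow_succ, one_div, mul_assoc, ← div_eq_inv_mul, le_div_iff₀ hδ]
        nlinarith
      have h9 : |t n - t m| ≤ (1 + |t n|) ^ (N + 1) * |t n - t m| :=
        le_mul_of_one_le_left (abs_nonneg _) (one_le_pow₀ (by simp))
      linarith
    have hwpos : 0 < ‖w - t m‖ := norm_pos_iff.2 (sub_ne_zero.2 (hw m))
    rw [norm_div, div_le_iff₀ hwpos, mul_div_assoc', div_mul_eq_mul_div,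
      le_div_iff₀ (by positivity)]
    have h10 : 1 + |t m| ≤ 2 * (1 + 1 / δ) * (1 + |t n|) ^ (N + 1) * ‖w - t m‖ := by
      refine h6.trans ?_
      have := mul_le_mul_of_nonneg_left h3
        (show 0 ≤ (1 + 1 / δ) * (1 + |t n|) ^ (N + 1) by positivity)
      linarith
    have := mul_le_mul_of_nonneg_left h10 (norm_nonneg (c m))
    linarith

/-- Under strong localization the masses decay faster than any power of `|tₙ|`. -/
lemma LocalizingRadii.finite_mass_gt (h : IsAdmissible I t μ) (hr : LocalizingRadii t μ r)
    (hδ : 0 < δ) (hsep : ∀ n m, n ≠ m → δ ≤ |t n - t m| * (1 + |t n|) ^ N) (L : ℕ) :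
    {n : I | 1 < Real.sqrt (μ n) * (1 + |t n|) ^ L}.Finite := by
  by_contra hinf
  obtain ⟨a, ha⟩ := h.exists_nonvanishing
  obtain ⟨p, hp⟩ := h.infinite.nonempty
  have ha0 : a ≠ 0 := by
    rintro rfl
    exact ha ⟨p, hp⟩ rfl
  have hc := summable_coeffs (fun n => (h.mass_pos n).le) h.summable a
  obtain ⟨D, hD0, hD⟩ := hr.exists_radius_le h
  have hB := (Set.not_finite.1 hinf).sdiff (hr.finite_not_close h ha0 (half_pos hδ) N)
  have hex : ∀ n : I, ∃ w : ℂ, n ∈ {n : I | 1 < Real.sqrt (μ n) * (1 + |t n|) ^ L} \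
      {n : I | a n ≠ 0 ∧ ¬ ∃ w : ℂ, w ∈ Metric.ball (t n : ℂ) (r n) ∧ w ≠ t n ∧
      nodeSum t (coeffs μ a) w = 0 ∧ ‖w - t n‖ * (1 + |t n|) ^ N < δ / 2} →
      w ∈ Metric.ball (t n : ℂ) (r n) ∧ w ≠ t n ∧
      nodeSum t (coeffs μ a) w = 0 ∧ ‖w - t n‖ * (1 + |t n|) ^ N < δ / 2 := by
    intro n
    by_cases hn : ∃ w : ℂ, w ∈ Metric.ball (t n : ℂ) (r n) ∧ w ≠ t n ∧
      nodeSum t (coeffs μ a) w = 0 ∧ ‖w - t n‖ * (1 + |t n|) ^ N < δ / 2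
    · exact ⟨hn.choose, fun _ => hn.choose_spec⟩
    · exact ⟨0, fun hn' => absurd ⟨ha n, hn⟩ hn'.2⟩
  choose w hw using hex
  set A := ∑' m, ‖coeffs μ a m‖ / (1 + |t m|)
  have hA : 0 ≤ A := tsum_nonneg fun m => by positivity
  -- The pole estimate bounds `‖a n‖ * √(μ n)` by a power times `‖w n - t n‖`. Where `√(μ n)`
  -- exceeds `(1 + |t n|) ^ (-L)`, this bounds `‖a n‖ * r n` likewise, making the zero movable.
  refine hr.not_infinite_movable (a := a) h hB (w := w) (C := 2 * (1 + 1 / δ) * A * D)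
    (L := N + 1 + L + 1) (by positivity) (fun n hn => (hw n hn).1) (fun n hn => (hw n hn).2.1)
    (fun n hn => (hw n hn).2.2.1) (fun n _ => ha n) fun n hn => ?_
  obtain ⟨hwb, hwt, hw0, hwc⟩ := hw n hn
  have h1 := norm_div_sub_le_of_nodeSum_eq_zero hc h.tendsto_abs hδ hsep
    (hr.ne_node_of_mem_closedBall (Metric.ball_subset_closedBall hwb) hwt) hw0 hwc
  rw [norm_div, div_le_iff₀ (norm_pos_iff.2 (sub_ne_zero.2 hwt)), coeffs, norm_mul,
    Complex.norm_real, Real.norm_of_nonneg (Real.sqrt_nonneg _)] at h1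
  have h2 : 1 < Real.sqrt (μ n) * (1 + |t n|) ^ L := hn.1
  calc ‖a n‖ * r n ≤ ‖a n‖ * (D * (1 + |t n|)) * 1 := by
        rw [mul_one]
        exact mul_le_mul_of_nonneg_left (hD n) (norm_nonneg _)
    _ ≤ ‖a n‖ * (D * (1 + |t n|)) * (Real.sqrt (μ n) * (1 + |t n|) ^ L) := by gcongr
    _ = (‖a n‖ * Real.sqrt (μ n)) * (D * (1 + |t n|) ^ (L + 1)) := by ring
    _ ≤ (2 * (1 + 1 / δ) * (1 + |t n|) ^ (N + 1) * A * ‖w n - t n‖) *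
        (D * (1 + |t n|) ^ (L + 1)) := by gcongr
    _ = _ := by ring

lemma LocalizingRadii.summable_mass_mul_pow (h : IsAdmissible I t μ) (hr : LocalizingRadii t μ r)
    (hδ : 0 < δ) (hδ1 : δ ≤ 1) (hsep : ∀ n m, n ≠ m → δ ≤ |t n - t m| * (1 + |t n|) ^ N) (k : ℕ) :
    Summable fun n => μ n * (1 + |t n|) ^ k := by
  refine Summable.of_norm_bounded_eventually (summable_inv_weight hδ hδ1 hsep) ?_
  filter_upwards [(hr.finite_mass_gt h hδ hsep (k + N + 2)).compl_mem_cofinite] with n hn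
  have h1 : Real.sqrt (μ n) * (1 + |t n|) ^ (k + N + 2) ≤ 1 := not_lt.1 hn
  have h2 : (1 : ℝ) ≤ 1 + |t n| := by simp
  rw [Real.norm_of_nonneg (mul_nonneg (h.mass_pos n).le (by positivity)), ← one_div,
    le_div_iff₀ (by positivity)]
  calc μ n * (1 + |t n|) ^ k * (1 + |t n|) ^ (N + 2)
      = Real.sqrt (μ n) ^ 2 * (1 + |t n|) ^ (k + N + 2) := by
        rw [Real.sq_sqrt (h.mass_pos n).le, mul_assoc, ← pow_add, add_assoc]
    _ ≤ Real.sqrt (μ n) ^ 2 * ((1 + |t n|) ^ (k + N + 2)) ^ 2 := by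
        gcongr
        exact le_self_pow₀ (one_le_pow₀ h2) two_ne_zero
    _ = (Real.sqrt (μ n) * (1 + |t n|) ^ (k + N + 2)) ^ 2 := by ring
    _ ≤ 1 := pow_le_one₀ (by positivity) h1

end Separation

/-! ### Vanishing through the maximum principle -/

section Vanishing

variable {ι : Type*} {t ρ : ι → ℝ} {c : ι → ℂ}

/-- There are arbitrarily large circles about `0` keeping distance `ρ m` from the node `t m`. -/
lemma exists_good_radius [Countable ι] (hρ0 : ∀ m, 0 < ρ m) (hρ : Summable ρ)
    (hρ1 : ∑' m, 2 * ρ m < 1) (K : ℕ) : ∃ R : ℝ, K ≤ R ∧ ∀ m, ρ m ≤ |(|t m| - R)| := by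
  by_contra! hcon
  -- Otherwise the forbidden radii would cover an interval of length one, while their total length
  -- is at most `∑ 2 * ρ m < 1`.
  have hsub : Set.Icc (K : ℝ) (K + 1) ⊆ ⋃ m, Set.Ioo (|t m| - ρ m) (|t m| + ρ m) := by
    intro R hR
    obtain ⟨m, hm⟩ := hcon R hR.1
    rw [abs_lt] at hm
    exact Set.mem_iUnion.2 ⟨m, by linarith [hm.2], by linarith [hm.1]⟩
  have h1 := (measure_mono hsub).trans (measure_iUnion_le (μ := volume) _)
  simp only [Real.volume_Icc, Real.volume_Ioo, add_sub_cancel_left, add_sub_sub_cancel] at h1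
  have h2 : ∑' m, ENNReal.ofReal (ρ m + ρ m) = ENNReal.ofReal (∑' m, 2 * ρ m) := by
    rw [ENNReal.ofReal_tsum_of_nonneg (fun m => by have := hρ0 m; positivity) (hρ.mul_left 2)]
    exact tsum_congr fun m => by rw [two_mul]
  rw [h2, ENNReal.ofReal_le_ofReal_iff (tsum_nonneg fun m => by have := hρ0 m; positivity)] at h1
  linarith

lemma prod_le_exp_tsum {x y : ι → ℝ} (F : Finset ι) (hx0 : ∀ n ∈ F, 0 ≤ x n)
    (hx : ∀ n ∈ F, x n ≤ 1 + y n) (hy0 : ∀ n, 0 ≤ y n) (hy : Summable y) :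
    ∏ n ∈ F, x n ≤ Real.exp (∑' n, y n) := by
  calc ∏ n ∈ F, x n ≤ ∏ n ∈ F, Real.exp (y n) := Finset.prod_le_prod hx0 fun n hn =>
        (hx n hn).trans (by rw [add_comm]; exact Real.add_one_le_exp _)
    _ = Real.exp (∑ n ∈ F, y n) := (Real.exp_sum F y).symm
    _ ≤ _ := Real.exp_le_exp.2 (hy.sum_le_tsum F fun n _ => hy0 n)

/-- Vanishing total mass gives `z * f z = ∑ c n * t n / (z - t n)`, hence decay of order `1 / ‖z‖`
at points keeping distance `ρ m` from the nodes. -/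
lemma norm_nodeSum_mul_le (hcρ : Summable fun n => ‖c n‖ * (1 + |t n|) / ρ n) (hρ0 : ∀ m, 0 < ρ m)
    (hc : Summable c) (h0 : ∑' n, c n = 0) {z : ℂ} (hz : ∀ m, ρ m ≤ ‖z - t m‖) :
    ‖nodeSum t c z‖ * ‖z‖ ≤ ∑' n, ‖c n‖ * (1 + |t n|) / ρ n := by
  have hpos : ∀ m, 0 < ‖z - t m‖ := fun m => (hρ0 m).trans_le (hz m)
  have hb : ∀ n, ‖c n * t n / (z - t n)‖ ≤ ‖c n‖ * (1 + |t n|) / ρ n := fun n => by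
    rw [norm_div, norm_mul, Complex.norm_real, Real.norm_eq_abs]
    have := hρ0 n
    gcongr
    · linarith
    · exact hz n
  have hs := Summable.of_norm_bounded hcρ hb
  have hs' := hc.add hs
  rw [← norm_mul]
  have : nodeSum t c z * z = ∑' n, c n * t n / (z - t n) := by
    rw [nodeSum, ← tsum_mul_right, ← zero_add (∑' n, c n * t n / (z - t n)), ← h0, ← hc.tsum_add hs]
    refine tsum_congr fun n => ?_
    have := norm_pos_iff.1 (hpos n)
    field_simp
    ring
  rw [this]
  exact tsum_of_norm_bounded hcρ.hasSum hb

/-- A sum over nodes with rapidly decaying coefficients and vanishing total mass, having a zero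
very close to each of its poles, vanishes identically. -/
lemma nodeSum_eq_zero_of_close_zeros [Countable ι] (ht : Tendsto (fun n => |t n|) cofinite atTop)
    (hρ0 : ∀ m, 0 < ρ m) (hρ : Summable ρ) (hρ1 : ∑' m, 2 * ρ m < 1)
    (hρsep : ∀ n m, n ≠ m → ρ n + ρ m ≤ |t n - t m|)
    (hcρ : Summable fun n => ‖c n‖ * (1 + |t n|) / ρ n) (h0 : ∑' n, c n = 0) {w : ι → ℂ}
    (hwt : ∀ n, c n ≠ 0 → ∀ m, w n ≠ t m) (hw0 : ∀ n, c n ≠ 0 → nodeSum t c (w n) = 0)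
    (hwc : ∀ n, c n ≠ 0 → ‖w n - t n‖ ≤ ρ n ^ 2) {z₀ : ℂ} (hz₀ : ∀ m, z₀ ≠ t m) :
    nodeSum t c z₀ = 0 := by
  classical
  by_contra hne
  have hρhalf : ∀ m, ρ m < 1 / 2 := fun m => by
    have := (hρ.mul_left 2).le_tsum m fun n _ => by have := hρ0 n; positivity
    linarith
  have hρ2 : ∀ m, ρ m ^ 2 ≤ ρ m / 2 := fun m => by nlinarith [hρ0 m, hρhalf m]
  have hcs : Summable fun n => ‖c n‖ := by
    refine Summable.of_nonneg_of_le (fun n => norm_nonneg _) (fun n => ?_) hcρ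
    rw [le_div_iff₀ (hρ0 n)]
    have : ρ n ≤ 1 + |t n| := by linarith [hρhalf n, abs_nonneg (t n)]
    gcongr
  have hcw : Summable fun n => ‖c n‖ / (1 + |t n|) :=
    Summable.of_nonneg_of_le (fun n => by positivity)
      (fun n => div_le_self (norm_nonneg _) (by simp)) hcs
  set A := ∑' n, ‖c n‖ * (1 + |t n|) / ρ n
  obtain ⟨D, hD0, hD⟩ := exists_weight_le ht hz₀
  set E₁ := Real.exp (∑' n, D * ρ n)
  set E₂ := Real.exp (∑' n, 2 * ρ n)
  have key : ∀ K : ℕ, ‖z₀‖ < K → ‖nodeSum t c z₀‖ ≤ E₁ * (E₂ * A) / K := by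
    intro K hK
    obtain ⟨R, hKR, hR⟩ := exists_good_radius hρ0 hρ hρ1 (t := t) K
    have hR0 : 0 < R := (norm_nonneg z₀).trans_lt (hK.trans_le hKR)
    have hfin : {n | |t n| < R}.Finite :=
      (show {n | ¬ R ≤ |t n|}.Finite from ht.eventually_ge_atTop R).subset fun n hn => not_le.2 hn
    set F : Finset ι := hfin.toFinset.filter fun n => c n ≠ 0 with hF
    have hFmem : ∀ n, n ∈ F ↔ |t n| < R ∧ c n ≠ 0 := fun n => by simp [hF]
    have hFw : ∀ n ∈ F, ∀ m, w n ≠ t m := fun n hn => hwt n ((hFmem n).1 hn).2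
    have hF0 : ∀ n ∈ F, nodeSum t c (w n) = 0 := fun n hn => hw0 n ((hFmem n).1 hn).2
    have hFc : ∀ n ∈ F, ‖w n - t n‖ ≤ ρ n ^ 2 := fun n hn => hwc n ((hFmem n).1 hn).2
    have hinj : Set.InjOn w F := by
      intro n hn m hm heq
      by_contra hnm
      have h1 := hρsep n m hnm
      have h2 := hFc n hn
      have h3 := hFc m hm
      rw [heq] at h2
      have h4 := norm_sub_le (w m - t m) (w m - t n)
      rw [sub_sub_sub_cancel_left, ← Complex.ofReal_sub, Complex.norm_real, Real.norm_eq_abs] at h4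
      linarith [hρ2 n, hρ2 m, hρ0 n, hρ0 m]
    -- This product trades the zeros `w n` inside the circle for the poles `t n`, so that its
    -- product with the sum is holomorphic in the disk.
    let Φ : ℂ → ℂ := factorProd (fun n => (t n : ℂ)) (fun _ => 1) w F
    let c' : ι → ℂ := fun n => c n * Φ (t n)
    obtain ⟨Q, hQ⟩ := exists_norm_factorProd_le (α := fun n => (t n : ℂ)) (β := fun _ => 1) ht hFw
    have hprod : ∀ z : ℂ, (∀ n, z ≠ t n) → (∀ n ∈ F, z ≠ w n) →
        nodeSum t c' z = nodeSum t c z * Φ z := fun z hz hzw =>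
      nodeSum_mul_factorProd ht hcw hinj hFw hF0 z hz hzw
    have hc'F : ∀ n ∈ F, c' n = 0 := fun n hn => by
      have : Φ (t n) = 0 := Finset.prod_eq_zero hn (by simp)
      simp [c', this]
    have hfar : ∀ n, c' n ≠ 0 → ∀ z : ℂ, ‖z‖ ≤ R → ρ n ≤ ‖z - t n‖ := by
      intro n hn z hz
      have hcn : c n ≠ 0 := fun h => hn (by simp [c', h])
      have h1 : R ≤ |t n| := by
        by_contra hlt
        exact hn (hc'F n ((hFmem n).2 ⟨not_le.1 hlt, hcn⟩))
      have h2 := hR n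
      rw [abs_of_nonneg (sub_nonneg.2 h1)] at h2
      have h3 := norm_sub_norm_le (t n : ℂ) z
      rw [Complex.norm_real, Real.norm_eq_abs, norm_sub_rev] at h3
      linarith
    have hbound : ∀ n, ∀ z : ℂ, ‖z‖ ≤ R → ‖c' n / (z - t n)‖ ≤ ‖c' n‖ / ρ n := by
      intro n z hz
      by_cases hn : c' n = 0
      · simp [hn]
      · rw [norm_div]
        have := hρ0 n
        gcongr
        exact hfar n hn z hz
    have hne' : ∀ n, c' n ≠ 0 → ∀ z : ℂ, ‖z‖ ≤ R → z - t n ≠ 0 := fun n hn z hz =>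
      norm_pos_iff.1 ((hρ0 n).trans_le (hfar n hn z hz))
    have hsum : Summable fun n => ‖c' n‖ / ρ n := by
      have hQ0 : ∀ n : ι, 0 ≤ Q := fun n => (norm_nonneg _).trans (hQ n)
      refine Summable.of_nonneg_of_le (fun n => by have := hρ0 n; positivity) (fun n => ?_)
        (hcρ.mul_left Q)
      rw [mul_div_assoc']
      have := hρ0 n
      have h1 : ‖c' n‖ ≤ ‖c n‖ * Q := by
        rw [norm_mul]
        exact mul_le_mul_of_nonneg_left (hQ n) (norm_nonneg _)
      gcongr
      have := mul_nonneg (mul_nonneg (norm_nonneg (c n)) (hQ0 n)) (abs_nonneg (t n))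
      linarith
    have hdiff : DiffContOnCl ℂ (nodeSum t c') (Metric.ball 0 R) := by
      constructor
      · refine Complex.differentiableOn_tsum_of_summable_norm hsum (fun n z hz => ?_)
          Metric.isOpen_ball fun n z hz => hbound n z (by simpa using (Metric.mem_ball.1 hz).le)
        by_cases hn : c' n = 0
        · simp only [hn, zero_div]; exact differentiableWithinAt_const 0
        · refine DifferentiableAt.differentiableWithinAt ?_
          refine DifferentiableAt.div (by fun_prop) (by fun_prop)
            (hne' n hn z (by simpa using (Metric.mem_ball.1 hz).le))
      · rw [closure_ball _ hR0.ne']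
        refine continuousOn_tsum (fun n z hz => ?_) hsum fun n z hz =>
          hbound n z (by simpa using hz)
        by_cases hn : c' n = 0
        · simp only [hn, zero_div]; exact continuousWithinAt_const
        · refine ContinuousAt.continuousWithinAt ?_
          refine ContinuousAt.div (by fun_prop) (by fun_prop) (hne' n hn z (by simpa using hz))
    have hwR : ∀ n ∈ F, ‖w n‖ ≤ R - ρ n / 2 := by
      intro n hn
      have h1 := hR n
      have h2 := ((hFmem n).1 hn).1
      rw [abs_of_neg (sub_neg.2 h2)] at h1
      have h3 := norm_sub_norm_le (w n) (t n)
      rw [Complex.norm_real, Real.norm_eq_abs] at h3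
      linarith [hFc n hn, hρ2 n]
    have hsphere : ∀ z ∈ frontier (Metric.ball (0 : ℂ) R), ‖nodeSum t c' z‖ ≤ E₂ * A / K := by
      intro z hz
      rw [frontier_ball _ hR0.ne', mem_sphere_zero_iff_norm] at hz
      have hzρ : ∀ m, ρ m ≤ ‖z - t m‖ := fun m => by
        refine (hR m).trans ?_
        have := abs_norm_sub_norm_le z (t m)
        rwa [hz, Complex.norm_real, Real.norm_eq_abs, abs_sub_comm] at this
      have hzw : ∀ n ∈ F, ρ n / 2 ≤ ‖w n - z‖ := fun n hn => by
        have := norm_sub_norm_le z (w n)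
        rw [hz, norm_sub_rev] at this
        linarith [hwR n hn]
      have hzw' : ∀ n ∈ F, w n - z ≠ 0 := fun n hn =>
        norm_pos_iff.1 ((half_pos (hρ0 n)).trans_le (hzw n hn))
      rw [hprod z (fun m => sub_ne_zero.1 (norm_pos_iff.1 ((hρ0 m).trans_le (hzρ m))))
        (fun n hn => (sub_ne_zero.1 (hzw' n hn)).symm), norm_mul]
      have h1 : ‖nodeSum t c z‖ ≤ A / K := by
        have hK0 : (0 : ℝ) < K := (norm_nonneg z₀).trans_lt hK
        rw [le_div_iff₀ hK0]
        refine le_trans ?_ (norm_nodeSum_mul_le hcρ hρ0 hcs.of_norm h0 hzρ)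
        rw [hz]
        gcongr
      -- On the circle `‖w n - t n‖ ≤ ρ n ^ 2` and `‖w n - z‖ ≥ ρ n / 2`, so each factor is at most
      -- `1 + 2 * ρ n`, uniformly in `K`.
      have h2 : ‖Φ z‖ ≤ E₂ := by
        simp only [Φ, factorProd, norm_prod]
        refine prod_le_exp_tsum F (fun _ _ => norm_nonneg _) (fun n hn => ?_)
          (fun n => by have := hρ0 n; positivity) (hρ.mul_left 2)
        have e : ((t n : ℂ) - 1 * z) / (w n - z) = 1 - (w n - t n) / (w n - z) := by
          have := hzw' n hn
          field_simp
          ring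
        rw [e]
        refine (norm_sub_le _ _).trans ?_
        rw [norm_one, norm_div]
        gcongr
        rw [div_le_iff₀ ((half_pos (hρ0 n)).trans_le (hzw n hn))]
        nlinarith [hFc n hn, hzw n hn, hρ0 n]
      have h3 : 0 ≤ A / K := (norm_nonneg _).trans h1
      calc ‖nodeSum t c z‖ * ‖Φ z‖ ≤ A / K * E₂ := by gcongr
        _ = _ := by ring
    have hz₀w : ∀ n ∈ F, z₀ ≠ w n := fun n hn heq => hne (heq ▸ hF0 n hn)
    have hmax : ‖nodeSum t c' z₀‖ ≤ E₂ * A / K :=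
      Complex.norm_le_of_forall_mem_frontier_norm_le Metric.isBounded_ball hdiff hsphere
        (subset_closure (by simpa using hK.trans_le hKR))
    rw [hprod z₀ hz₀ hz₀w, norm_mul] at hmax
    -- The reciprocal factors at the fixed point `z₀` are at most `1 + D * ρ n`, so the bound on the
    -- modified sum returns to the original one.
    have hΦ : ‖Φ z₀‖⁻¹ ≤ E₁ := by
      simp only [Φ, factorProd, norm_prod, ← Finset.prod_inv_distrib]
      refine prod_le_exp_tsum F (fun _ _ => inv_nonneg.2 (norm_nonneg _)) (fun n hn => ?_)
          (fun n => by have := hρ0 n; positivity) (hρ.mul_left D)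
      have h1 := sub_ne_zero.2 (hz₀ n).symm
      have h2 := sub_ne_zero.2 (hz₀w n hn).symm
      have e : (((t n : ℂ) - 1 * z₀) / (w n - z₀))⁻¹ = 1 + (w n - t n) / (t n - z₀) := by
        rw [one_mul]
        field_simp
        ring
      rw [← norm_inv, e]
      refine (norm_add_le _ _).trans ?_
      rw [norm_one, norm_div]
      gcongr
      rw [div_le_iff₀ (norm_pos_iff.2 h1)]
      have h3 : 1 ≤ D * ‖(t n : ℂ) - z₀‖ := by
        rw [norm_sub_rev]
        exact le_trans (by simp) (hD n)
      nlinarith [hFc n hn, hρ2 n, hρ0 n]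
    have hΦ0 : 0 < ‖Φ z₀‖ := norm_pos_iff.2 <| Finset.prod_ne_zero_iff.2 fun n hn => by
      refine div_ne_zero ?_ (sub_ne_zero.2 (hz₀w n hn).symm)
      rw [one_mul]
      exact sub_ne_zero.2 (hz₀ n).symm
    calc ‖nodeSum t c z₀‖ = ‖Φ z₀‖⁻¹ * (‖nodeSum t c z₀‖ * ‖Φ z₀‖) := by field_simp
      _ ≤ E₁ * (E₂ * A / K) := by gcongr
      _ = _ := by ring
  have hlim : Tendsto (fun K : ℕ => E₁ * (E₂ * A) / (K : ℝ)) atTop (𝓝 0) :=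
    tendsto_natCast_atTop_atTop.const_div_atTop _
  have hle : ‖nodeSum t c z₀‖ ≤ 0 := by
    refine ge_of_tendsto hlim ?_
    filter_upwards [tendsto_natCast_atTop_atTop.eventually_gt_atTop ‖z₀‖] with K hK using key K hK
  exact hne (norm_le_zero_iff.1 hle)

end Vanishing

/-! ### Coefficients with vanishing power moments -/

section Moments

variable {ι : Type*} {t μ : ι → ℝ} {c : ι → ℂ}

lemma summable_coeffs_mul_pow (hμ0 : ∀ n, 0 ≤ μ n)
    (hμ : ∀ k : ℕ, Summable fun n => μ n * (1 + |t n|) ^ k) (a : lp (fun _ : ι => ℂ) 2) (k : ℕ) :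
    Summable fun n => ‖coeffs μ a n‖ * (1 + |t n|) ^ k := by
  have h2 := (lp.memℓp a).summable (by simp)
  simp only [ENNReal.toReal_ofNat, Real.rpow_ofNat] at h2
  refine Summable.of_nonneg_of_le (fun n => by positivity) (fun n => ?_) (h2.add (hμ (2 * k)))
  have h3 : μ n * (1 + |t n|) ^ (2 * k) = (Real.sqrt (μ n) * (1 + |t n|) ^ k) ^ 2 := by
    rw [mul_pow, Real.sq_sqrt (hμ0 n), ← pow_mul, mul_comm k]
  rw [coeffs, norm_mul, Complex.norm_real, Real.norm_of_nonneg (Real.sqrt_nonneg _), h3, mul_assoc]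
  nlinarith [sq_nonneg (‖a n‖ - Real.sqrt (μ n) * (1 + |t n|) ^ k), sq_nonneg (‖a n‖),
    sq_nonneg (Real.sqrt (μ n) * (1 + |t n|) ^ k)]

lemma summable_mul_pow (hc : ∀ k : ℕ, Summable fun n => ‖c n‖ * (1 + |t n|) ^ k) (k : ℕ) :
    Summable fun n => c n * (t n : ℂ) ^ k := by
  refine Summable.of_norm_bounded (hc k) fun n => ?_
  rw [norm_mul, norm_pow, Complex.norm_real, Real.norm_eq_abs]
  gcongr
  linarith

/-- The coefficients `c` decay rapidly and all their power moments vanish. -/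
structure NullMoments (t : ι → ℝ) (c : ι → ℂ) : Prop where
  summable : ∀ k : ℕ, Summable fun n => ‖c n‖ * (1 + |t n|) ^ k
  moment : ∀ k : ℕ, ∑' n, c n * (t n : ℂ) ^ k = 0

namespace NullMoments

lemma mul_sub (h : NullMoments t c) (s : ℝ) : NullMoments t fun n => c n * (t n - s) where
  summable k := by
    refine Summable.of_nonneg_of_le (fun n => by positivity) (fun n => ?_)
      ((h.summable (k + 1)).mul_left (1 + |s|))
    have h1 : ‖(t n : ℂ) - s‖ ≤ (1 + |s|) * (1 + |t n|) := by
      rw [← Complex.ofReal_sub, Complex.norm_real, Real.norm_eq_abs]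
      have := abs_sub (t n) s
      nlinarith [abs_nonneg (t n), abs_nonneg s]
    calc ‖c n * (t n - s)‖ * (1 + |t n|) ^ k
        ≤ ‖c n‖ * ((1 + |s|) * (1 + |t n|)) * (1 + |t n|) ^ k := by
          rw [norm_mul]
          gcongr
      _ = _ := by ring
  moment k := by
    have h1 := summable_mul_pow h.summable (k + 1)
    have h2 := (summable_mul_pow h.summable k).mul_left (s : ℂ)
    have h3 : ∀ n, c n * (t n - s) * (t n : ℂ) ^ k =
        c n * (t n : ℂ) ^ (k + 1) - s * (c n * (t n : ℂ) ^ k) := fun n => by ring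
    simp_rw [h3]
    rw [h1.tsum_sub h2, tsum_mul_left, h.moment, h.moment]
    simp

lemma summable_weight (h : NullMoments t c) : Summable fun n => ‖c n‖ / (1 + |t n|) :=
  Summable.of_nonneg_of_le (fun n => by positivity)
    (fun n => by
      rw [pow_zero, mul_one]
      exact div_le_self (norm_nonneg _) (by simp)) (h.summable 0)

/-- The new sum at `w` is `(w - s) * f w` minus the zeroth moment, so both terms vanish. -/
lemma nodeSum_mul_sub (h : NullMoments t c) (ht : Tendsto (fun n => |t n|) cofinite atTop) (s : ℝ)
    {w : ℂ} (hw : ∀ n, w ≠ t n) (h0 : nodeSum t c w = 0) :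
    nodeSum t (fun n => c n * (t n - s)) w = 0 := by
  obtain ⟨C, -, hC⟩ := exists_weight_le ht hw
  have h1 := (summable_div_sub h.summable_weight hw hC).mul_left (w - s)
  have h2 := summable_mul_pow h.summable 0
  have h3 : ∀ n, c n * (t n - s) / (w - t n) =
      (w - s) * (c n / (w - t n)) - c n * (t n : ℂ) ^ 0 := fun n => by
    have := sub_ne_zero.2 (hw n)
    field_simp
    ring
  rw [nodeSum] at h0 ⊢
  simp_rw [h3]
  rw [h1.tsum_sub h2, tsum_mul_left, h0, h.moment]
  simp

/-- Finitely many coefficients can be annihilated, keeping the zeros of the node sum. -/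
lemma exists_annihilated (h : NullMoments t c) (ht : Tendsto (fun n => |t n|) cofinite atTop)
    (hinj : Function.Injective t) (F : Finset ι) :
    ∃ d : ι → ℂ, NullMoments t d ∧ (∀ n ∈ F, d n = 0) ∧ (∀ n ∉ F, d n = 0 → c n = 0) ∧
      (∀ n, c n = 0 → d n = 0) ∧
      ∀ w : ℂ, (∀ n, w ≠ t n) → nodeSum t c w = 0 → nodeSum t d w = 0 := by
  classical
  induction F using Finset.induction_on with
  | empty => exact ⟨c, h, by simp, fun _ _ => id, fun _ => id, fun _ _ => id⟩
  | insert m F hm ih =>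
    obtain ⟨d, hd, h1, h2, h3, h4⟩ := ih
    refine ⟨_, hd.mul_sub (t m), fun n hn => ?_, fun n hn h0 => ?_, fun n hn => ?_,
      fun w hw h0 => hd.nodeSum_mul_sub ht _ hw (h4 w hw h0)⟩
    · rcases Finset.mem_insert.1 hn with rfl | hn
      · simp
      · simp [h1 n hn]
    · rw [Finset.mem_insert, not_or] at hn
      exact h2 n hn.2 ((mul_eq_zero.1 h0).resolve_right
        (sub_ne_zero.2 (by exact_mod_cast hinj.ne hn.1)))
    · simp [h3 n hn]

/-- Annihilating every coefficient of the finite support except one leaves a single term, which the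
zeroth moment forces to vanish. -/
lemma eq_zero_of_support_finite (h : NullMoments t c)
    (ht : Tendsto (fun n => |t n|) cofinite atTop) (hinj : Function.Injective t) {F : Finset ι}
    (hF : ∀ n ∉ F, c n = 0) (n : ι) : c n = 0 := by
  classical
  obtain ⟨d, hd, h1, h2, h3, -⟩ := h.exists_annihilated ht hinj (F.erase n)
  refine h2 n (Finset.notMem_erase n F) ?_
  have h4 := hd.moment 0
  rw [tsum_eq_single n fun m hm => ?_] at h4
  · simpa using h4
  · by_cases hmF : m ∈ F
    · rw [h1 m (Finset.mem_erase.2 ⟨hm, hmF⟩), zero_mul]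
    · rw [h3 m (hF m hmF), zero_mul]

end NullMoments

end Moments

/-! ### Localization forces density -/

section Necessity

variable {I : Set ℤ} {t μ r : I → ℝ} {δ : ℝ} {N : ℕ}

/-- All but finitely many nodes with `a n ≠ 0` have a zero extremely close by; the exceptional
coefficients are annihilated without losing those zeros. The maximum principle kills the resulting
sum, so the original coefficients have finite support and the moments finish. -/
lemma LocalizingRadii.eq_zero_of_nullMoments (h : IsAdmissible I t μ) (hr : LocalizingRadii t μ r)
    (hδ : 0 < δ) (hδ1 : δ ≤ 1) (hsep : ∀ n m, n ≠ m → δ ≤ |t n - t m| * (1 + |t n|) ^ N)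
    {a : lp (fun _ : I => ℂ) 2} (ha : NullMoments t (coeffs μ a)) : a = 0 := by
  by_contra hne
  have ht := h.tendsto_abs
  have hinj := h.strictMono.injective
  have hs := summable_inv_weight hδ hδ1 hsep
  set S := ∑' n, ((1 + |t n|) ^ (N + 2))⁻¹
  have hS0 : 0 ≤ S := tsum_nonneg fun n => by positivity
  -- The scale `κ` makes `∑ 2 * ρ n < 1` and keeps `ρ n` below half the separation. Closeness with
  -- the exponent `2 * (N + 2)` and the constant `κ ^ 2` is then exactly `ρ n ^ 2`.
  obtain ⟨κ, hκ0, hκδ, hκS⟩ : ∃ κ : ℝ, 0 < κ ∧ κ ≤ δ / 2 ∧ 2 * κ * S < 1 := by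
    refine ⟨min (δ / 2) (1 / (2 * S + 1) / 2), by positivity, min_le_left _ _, ?_⟩
    have h1 := min_le_right (δ / 2) (1 / (2 * S + 1) / 2)
    calc 2 * min (δ / 2) (1 / (2 * S + 1) / 2) * S ≤ 2 * (1 / (2 * S + 1) / 2) * S := by gcongr
      _ = S / (2 * S + 1) := by ring
      _ < 1 := by rw [div_lt_one (by positivity)]; linarith
  let ρ : I → ℝ := fun n => κ * ((1 + |t n|) ^ (N + 2))⁻¹
  have hρ0 : ∀ n, 0 < ρ n := fun n => by positivity
  have hρ : Summable ρ := hs.mul_left κ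
  have hρ1 : ∑' n, 2 * ρ n < 1 := by
    rw [tsum_mul_left, tsum_mul_left, ← mul_assoc]
    exact hκS
  have hρsep' : ∀ n m, n ≠ m → ρ n ≤ |t n - t m| / 2 := fun n m hnm => by
    have h1 := hsep n m hnm
    have h2 : (1 : ℝ) ≤ 1 + |t n| := by simp
    simp only [ρ]
    rw [← div_eq_mul_inv, div_le_iff₀ (by positivity)]
    have h3 : (1 + |t n|) ^ N ≤ (1 + |t n|) ^ (N + 2) := pow_le_pow_right₀ h2 (by omega)
    have h4 := mul_le_mul_of_nonneg_left h3 (abs_nonneg (t n - t m))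
    linarith
  have hρsep : ∀ n m, n ≠ m → ρ n + ρ m ≤ |t n - t m| := fun n m hnm => by
    have h1 := hρsep' n m hnm
    have h2 := hρsep' m n hnm.symm
    rw [abs_sub_comm] at h2
    linarith
  have hfin := hr.finite_not_close h hne (show 0 < κ ^ 2 by positivity) (2 * (N + 2))
  obtain ⟨d, hd, h1, h2, h3, h4⟩ := ha.exists_annihilated ht hinj hfin.toFinset
  have hex : ∀ n, ∃ w : ℂ, d n ≠ 0 → (∀ m, w ≠ t m) ∧ nodeSum t d w = 0 ∧
      ‖w - t n‖ ≤ ρ n ^ 2 := by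
    intro n
    by_cases hdn : d n = 0
    · exact ⟨0, fun h => absurd hdn h⟩
    · have h5 : n ∉ hfin.toFinset := fun hn => hdn (h1 n hn)
      have h6 : a n ≠ 0 := fun h0 => hdn (h3 n (by rw [coeffs, h0, zero_mul]))
      rw [Set.Finite.mem_toFinset, Set.mem_ofPred_eq, not_and_not_right] at h5
      obtain ⟨w, hwb, hwt, hw0, hwc⟩ := h5 h6
      have h7 := hr.ne_node_of_mem_closedBall (Metric.ball_subset_closedBall hwb) hwt
      refine ⟨w, fun _ => ⟨h7, h4 w h7 hw0, ?_⟩⟩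
      simp only [ρ]
      rw [mul_pow, inv_pow, ← pow_mul, mul_comm (N + 2), ← div_eq_mul_inv,
        le_div_iff₀ (by positivity)]
      exact hwc.le
  choose w hw using hex
  have hd0 : ∀ n, d n = 0 := by
    refine eq_zero_of_nodeSum_eq_zero ht hinj hd.summable_weight fun z hz => ?_
    refine nodeSum_eq_zero_of_close_zeros ht hρ0 hρ hρ1 hρsep ?_ (by simpa using hd.moment 0)
      (fun n hn => (hw n hn).1) (fun n hn => (hw n hn).2.1) (fun n hn => (hw n hn).2.2) hz
    refine ((hd.summable (N + 3)).mul_left κ⁻¹).congr fun n => ?_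
    simp only [ρ]
    field_simp
    ring
  refine hne (h.coeffs_eq_zero fun z _ => ?_)
  simp [nodeSum, ha.eq_zero_of_support_finite ht hinj (fun n hn => h2 n hn (hd0 n))]

end Necessity

/-! ### Square integrability over the discrete measure -/

section SquareIntegrable

variable {I : Set ℤ} {t μ : I → ℝ}

lemma aestronglyMeasurable_discreteMeasure (f : ℝ → ℂ) :
    AEStronglyMeasurable f (discreteMeasure t μ) :=
  aestronglyMeasurable_sum_measure_iff.2 fun _ => aestronglyMeasurable_dirac.smul_measure _

lemma ae_discreteMeasure_iff (hμ : ∀ n, 0 < μ n) {p : ℝ → Prop} :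
    (∀ᵐ x ∂discreteMeasure t μ, p x) ↔ ∀ n, p (t n) := by
  rw [discreteMeasure, Measure.ae_sum_iff]
  refine forall_congr' fun n => ?_
  rw [Measure.ae_ennreal_smul_measure_iff (by simpa using hμ n), ae_dirac_eq, eventually_pure]

lemma memLp_discreteMeasure_iff (hμ : ∀ n, 0 < μ n) (f : ℝ → ℂ) :
    MemLp f 2 (discreteMeasure t μ) ↔ Summable fun n => μ n * ‖f (t n)‖ ^ 2 := by
  rw [memLp_two_iff_integrable_sq_norm (aestronglyMeasurable_discreteMeasure f), discreteMeasure,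
    integrable_sum_measure_iff]
  have h1 : ∀ n, Integrable (fun x => ‖f x‖ ^ 2) (ENNReal.ofReal (μ n) • Measure.dirac (t n)) :=
    fun n => (integrable_dirac (by simp)).smul_measure (by simp)
  simp only [h1, implies_true, true_and]
  refine summable_congr fun n => ?_
  rw [integral_smul_measure, integral_dirac, ENNReal.toReal_ofReal (hμ n).le, smul_eq_mul,
    Real.norm_of_nonneg (by positivity)]

lemma hasSum_integral_discreteMeasure (hμ : ∀ n, 0 < μ n) {f : ℝ → ℂ}
    (hf : Integrable f (discreteMeasure t μ)) :
    HasSum (fun n => (μ n : ℂ) * f (t n)) (∫ x, f x ∂discreteMeasure t μ) := by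
  have := hasSum_integral_measure (f := f) (μ := fun n => ENNReal.ofReal (μ n) • Measure.dirac (t n)) hf
  refine this.congr_fun fun n => ?_
  rw [integral_smul_measure, integral_dirac, ENNReal.toReal_ofReal (hμ n).le, Complex.real_smul]

lemma norm_eval_le (p : Polynomial ℂ) : ∃ C : ℝ, ∀ x : ℝ,
    ‖p.eval (x : ℂ)‖ ≤ C * (1 + |x|) ^ p.natDegree := by
  refine ⟨∑ i ∈ Finset.range (p.natDegree + 1), ‖p.coeff i‖, fun x => ?_⟩
  rw [Polynomial.eval_eq_sum_range, Finset.sum_mul]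
  refine (norm_sum_le _ _).trans (Finset.sum_le_sum fun i hi => ?_)
  rw [norm_mul, norm_pow, Complex.norm_real, Real.norm_eq_abs]
  have h1 : |x| ^ i ≤ (1 + |x|) ^ i := by gcongr; linarith
  have h2 : (1 + |x|) ^ i ≤ (1 + |x|) ^ p.natDegree :=
    pow_le_pow_right₀ (by simp) (Nat.lt_succ_iff.1 (Finset.mem_range.1 hi))
  gcongr
  exact h1.trans h2

lemma polynomialsInL2_iff (hμ : ∀ n, 0 < μ n) :
    PolynomialsInL2 (discreteMeasure t μ) ↔
      ∀ k : ℕ, Summable fun n => μ n * (1 + |t n|) ^ k := by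
  refine ⟨fun hp k => ?_, fun hk p => ?_⟩
  · have h1 := (memLp_discreteMeasure_iff hμ _).1 (hp ((1 + Polynomial.X ^ 2) ^ k))
    refine Summable.of_nonneg_of_le (fun n => mul_nonneg (hμ n).le (by positivity)) (fun n => ?_)
      (h1.mul_left (2 ^ k))
    have h2 : ‖((1 + Polynomial.X ^ 2 : Polynomial ℂ) ^ k).eval (t n : ℂ)‖ = (1 + t n ^ 2) ^ k := by
      rw [Polynomial.eval_pow, norm_pow, Polynomial.eval_add, Polynomial.eval_one,
        Polynomial.eval_pow, Polynomial.eval_X, ← Complex.ofReal_pow, ← Complex.ofReal_one,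
        ← Complex.ofReal_add, Complex.norm_real, Real.norm_of_nonneg (by positivity)]
    rw [h2, ← pow_mul, mul_left_comm]
    refine mul_le_mul_of_nonneg_left ?_ (hμ n).le
    calc (1 + |t n|) ^ k ≤ (2 * (1 + t n ^ 2)) ^ k := by
          gcongr
          nlinarith [sq_nonneg (|t n| - 1), sq_abs (t n)]
      _ = 2 ^ k * (1 + t n ^ 2) ^ k := mul_pow _ _ _
      _ ≤ 2 ^ k * (1 + t n ^ 2) ^ (k * 2) := by
          gcongr
          · nlinarith [sq_nonneg (t n)]
          · omega
  · obtain ⟨C, hC⟩ := norm_eval_le p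
    rw [memLp_discreteMeasure_iff hμ]
    refine Summable.of_nonneg_of_le (fun n => mul_nonneg (hμ n).le (by positivity)) (fun n => ?_)
      ((hk (p.natDegree * 2)).mul_left (C ^ 2))
    calc μ n * ‖p.eval (t n : ℂ)‖ ^ 2 ≤ μ n * (C * (1 + |t n|) ^ p.natDegree) ^ 2 := by
          have := (hμ n).le
          gcongr
          exact hC (t n)
      _ = _ := by ring

end SquareIntegrable

/-! ### Density of polynomials as a moment condition -/

section Density

variable {I : Set ℤ} {t μ : I → ℝ}

/-- The subspace of classes of polynomials in `L²(ν)`. -/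
def polynomialSubmodule (ν : Measure ℝ) : Submodule ℂ (Lp ℂ 2 ν) where
  carrier := {g : Lp ℂ 2 ν | ∃ p : Polynomial ℂ, g =ᵐ[ν] fun x : ℝ => p.eval (x : ℂ)}
  add_mem' := by
    rintro f g ⟨p, hp⟩ ⟨q, hq⟩
    refine ⟨p + q, (Lp.coeFn_add f g).trans ?_⟩
    filter_upwards [hp, hq] with x h1 h2
    rw [Pi.add_apply, h1, h2, Polynomial.eval_add]
  zero_mem' := ⟨0, by
    filter_upwards [Lp.coeFn_zero ℂ 2 ν] with x hx
    rw [hx, Polynomial.eval_zero, Pi.zero_apply]⟩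
  smul_mem' := by
    rintro c f ⟨p, hp⟩
    refine ⟨c • p, (Lp.coeFn_smul c f).trans ?_⟩
    filter_upwards [hp] with x h1
    rw [Pi.smul_apply, h1, Polynomial.eval_smul]

lemma polynomialsDenseInL2_iff_orthogonal (ν : Measure ℝ) :
    PolynomialsDenseInL2 ν ↔ (polynomialSubmodule ν)ᗮ = ⊥ := by
  rw [← Submodule.topologicalClosure_eq_top_iff, ← Submodule.dense_iff_topologicalClosure_eq_top]
  rfl

lemma hasSum_inner_discreteMeasure (hμ : ∀ n, 0 < μ n) (f g : Lp ℂ 2 (discreteMeasure t μ)) :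
    HasSum (fun n => (μ n : ℂ) * (g (t n) * (starRingEnd ℂ) (f (t n)))) (inner ℂ f g) := by
  have h1 : Integrable (fun x => inner ℂ (f x) (g x)) (discreteMeasure t μ) :=
    L2.integrable_inner f g
  have h2 := hasSum_integral_discreteMeasure hμ h1
  rw [L2.inner_def]
  simpa only [RCLike.inner_apply] using h2

lemma tsum_coeffs_mul_eval {a : lp (fun _ : I => ℂ) 2}
    (ha : NullMoments t (coeffs μ a)) (p : Polynomial ℂ) :
    ∑' n, coeffs μ a n * p.eval (t n : ℂ) = 0 := by
  simp_rw [Polynomial.eval_eq_sum_range, Finset.mul_sum, mul_left_comm _ (p.coeff _)]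
  rw [Summable.tsum_finsetSum fun k _ => (summable_mul_pow ha.summable k).mul_left _]
  refine Finset.sum_eq_zero fun k _ => ?_
  rw [tsum_mul_left, ha.moment, mul_zero]

/-- Polynomials are dense if and only if no nonzero coefficient sequence has null moments. -/
lemma polynomialsDenseInL2_iff (hinj : Function.Injective t) (hμ : ∀ n, 0 < μ n)
    (hp : PolynomialsInL2 (discreteMeasure t μ)) :
    PolynomialsDenseInL2 (discreteMeasure t μ) ↔
      ∀ a : lp (fun _ : I => ℂ) 2, NullMoments t (coeffs μ a) → a = 0 := by
  have hμ0 := fun n => (hμ n).le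
  have hsq : ∀ n, (Real.sqrt (μ n) : ℂ) * Real.sqrt (μ n) = μ n := fun n => by
    rw [← Complex.ofReal_mul, Real.mul_self_sqrt (hμ0 n)]
  have hsq0 : ∀ n, (Real.sqrt (μ n) : ℂ) ≠ 0 := fun n =>
    Complex.ofReal_ne_zero.2 (Real.sqrt_pos.2 (hμ n)).ne'
  rw [polynomialsDenseInL2_iff_orthogonal, Submodule.eq_bot_iff]
  constructor
  · intro h a ha
    -- With this choice the inner product of a polynomial `p` with `g` is the conjugate of `∑ coeffs
    -- μ a n * p (t n)`, so null moments mean orthogonality.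
    let g : ℝ → ℂ := Function.extend t (fun n => (starRingEnd ℂ) (a n) / Real.sqrt (μ n)) 0
    have hg : ∀ n, g (t n) = (starRingEnd ℂ) (a n) / Real.sqrt (μ n) := fun n =>
      hinj.extend_apply _ _ n
    have hgL : MemLp g 2 (discreteMeasure t μ) := by
      rw [memLp_discreteMeasure_iff hμ]
      have h2 := (lp.memℓp a).summable (by simp)
      simp only [ENNReal.toReal_ofNat, Real.rpow_ofNat] at h2
      refine h2.congr fun n => ?_
      rw [hg, norm_div, RCLike.norm_conj, Complex.norm_real, div_pow, Real.norm_eq_abs, sq_abs,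
        Real.sq_sqrt (hμ0 n)]
      have := (hμ n).ne'
      field_simp
    have hgt := (ae_discreteMeasure_iff hμ).1 hgL.coeFn_toLp
    have h0 := h (hgL.toLp g) (by
      rw [Submodule.mem_orthogonal]
      rintro f ⟨p, hf⟩
      have hft := (ae_discreteMeasure_iff hμ).1 hf
      rw [← (hasSum_inner_discreteMeasure hμ f (hgL.toLp g)).tsum_eq, ← map_zero (starRingEnd ℂ),
        ← tsum_coeffs_mul_eval ha p, Complex.conj_tsum]
      refine tsum_congr fun n => ?_
      rw [hgt, hg, hft, coeffs, map_mul, map_mul, Complex.conj_ofReal, ← hsq n]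
      have := hsq0 n
      field_simp)
    ext n
    have h1 := (ae_discreteMeasure_iff hμ).1 (Lp.coeFn_zero ℂ 2 (discreteMeasure t μ)) n
    rw [← h0, hgt, hg, Pi.zero_apply, div_eq_zero_iff] at h1
    simpa using h1.resolve_right (hsq0 n)
  · intro h v hv
    have hvs := (memLp_discreteMeasure_iff hμ _).1 (Lp.memLp v)
    -- The inverse correspondence: orthogonality of `v` to `x ^ k` becomes vanishing of the `k`-th
    -- moment.
    let a : lp (fun _ : I => ℂ) 2 :=
      ⟨fun n => (starRingEnd ℂ) (v (t n)) * Real.sqrt (μ n), memℓp_gen (by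
        refine hvs.congr fun n => ?_
        rw [ENNReal.toReal_ofNat, Real.rpow_ofNat, norm_mul, RCLike.norm_conj, Complex.norm_real,
          mul_pow, Real.norm_eq_abs, sq_abs, Real.sq_sqrt (hμ0 n), mul_comm])⟩
    have ha : NullMoments t (coeffs μ a) := by
      refine ⟨summable_coeffs_mul_pow hμ0 ((polynomialsInL2_iff hμ).1 hp) a, fun k => ?_⟩
      have hk := hp (Polynomial.X ^ k)
      have hkt := (ae_discreteMeasure_iff hμ).1 hk.coeFn_toLp
      have h1 := (Submodule.mem_orthogonal _ _).1 hv (hk.toLp _) ⟨_, hk.coeFn_toLp⟩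
      rw [← (hasSum_inner_discreteMeasure hμ _ v).tsum_eq, ← map_eq_zero (starRingEnd ℂ),
        Complex.conj_tsum] at h1
      rw [← h1]
      refine tsum_congr fun n => ?_
      rw [hkt, coeffs, map_mul, map_mul, Complex.conj_conj, Complex.conj_ofReal, ← hsq n]
      simp only [a, Polynomial.eval_pow, Polynomial.eval_X]
      ring
    have ha0 := h a ha
    refine Lp.ext ?_
    refine EventuallyEq.trans ?_ (Lp.coeFn_zero ℂ 2 _).symm
    refine (ae_discreteMeasure_iff hμ).2 fun n => ?_
    have h1 : (starRingEnd ℂ) (v (t n)) * Real.sqrt (μ n) = 0 := by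
      have : a n = 0 := by rw [ha0]; rfl
      exact this
    simpa using (mul_eq_zero.1 h1).resolve_right (hsq0 n)

end Density

/-! ### Density forces localization -/

section Sufficiency

variable {ι : Type*} {t : ι → ℝ} {c : ι → ℂ}

/-- The expansion of a node sum at infinity when the first moments vanish. -/
lemma pow_mul_nodeSum (ht : Tendsto (fun n => |t n|) cofinite atTop)
    (hc : ∀ k : ℕ, Summable fun n => ‖c n‖ * (1 + |t n|) ^ k) {z : ℂ} (hz : ∀ n, z ≠ t n) (K : ℕ)
    (h0 : ∀ k < K, ∑' n, c n * (t n : ℂ) ^ k = 0) :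
    z ^ K * nodeSum t c z = nodeSum t (fun n => c n * (t n : ℂ) ^ K) z := by
  obtain ⟨C, -, hC⟩ := exists_weight_le ht hz
  have hs : ∀ k : ℕ, Summable fun n => c n * (t n : ℂ) ^ k / (z - t n) := fun k => by
    refine summable_div_sub ?_ hz hC
    refine Summable.of_nonneg_of_le (fun n => by positivity) (fun n => ?_) (hc k)
    refine (div_le_self (norm_nonneg _) (by simp)).trans ?_
    rw [norm_mul, norm_pow, Complex.norm_real, Real.norm_eq_abs]
    gcongr
    linarith
  induction K with
  | zero => simp
  | succ K ih =>
    rw [pow_succ', mul_assoc, ih fun k hk => h0 k (by omega)]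
    have h1 : ∀ n, c n * (t n : ℂ) ^ (K + 1) / (z - t n) =
        z * (c n * (t n : ℂ) ^ K / (z - t n)) - c n * (t n : ℂ) ^ K := fun n => by
      have := sub_ne_zero.2 (hz n)
      field_simp
      ring
    unfold nodeSum
    simp_rw [h1]
    rw [((hs K).mul_left z).tsum_sub (summable_mul_pow hc K), tsum_mul_left, h0 K (by omega),
      sub_zero]

end Sufficiency

section Sufficiency

/-- Banach's theorem applies on the closed ball of half the radius, which is complete and mapped to
itself; the contraction estimate on the whole open ball extends uniqueness to it. -/
lemma existsUnique_fixedPoint_ball {Φ : ℂ → ℂ} {x : ℂ} {r : ℝ} (hr : 0 < r)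
    (hmaps : ∀ z ∈ Metric.ball x r, ‖Φ z - x‖ ≤ r / 2)
    (hlip : ∀ z ∈ Metric.ball x r, ∀ z' ∈ Metric.ball x r, ‖Φ z - Φ z'‖ ≤ 1 / 2 * ‖z - z'‖) :
    ∃! z : ℂ, z ∈ Metric.ball x r ∧ Φ z = z := by
  have hsub : Metric.closedBall x (r / 2) ⊆ Metric.ball x r :=
    Metric.closedBall_subset_ball (half_lt_self hr)
  have hm : Set.MapsTo Φ (Metric.closedBall x (r / 2)) (Metric.closedBall x (r / 2)) :=
    fun z hz => by
      rw [Metric.mem_closedBall, dist_eq_norm]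
      exact hmaps z (hsub hz)
  have hc : ContractingWith (1 / 2) (hm.restrict Φ _ _) := by
    refine ⟨by
      rw [← NNReal.coe_lt_coe]
      norm_num, LipschitzWith.of_dist_le_mul fun z z' => ?_⟩
    have := hlip z (hsub z.2) z' (hsub z'.2)
    rw [Subtype.dist_eq, Subtype.dist_eq, dist_eq_norm, dist_eq_norm]
    simpa using this
  obtain ⟨z, hz, hfix, -⟩ := hc.exists_fixedPoint' Metric.isClosed_closedBall.isComplete hm
    (Metric.mem_closedBall_self (half_pos hr).le) (edist_ne_top _ _)
  refine ⟨z, ⟨hsub hz, hfix⟩, fun z' hz' => ?_⟩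
  have := hlip z' hz'.1 z (hsub hz)
  rw [hz'.2, hfix] at this
  rw [← sub_eq_zero, ← norm_le_zero_iff]
  linarith

section Remainder

variable {ι : Type*} [DecidableEq ι] {t r : ι → ℝ} {d : ι → ℂ}

/-- The sum `∑ₘ dₘ / (z - tₘ)` without the term `m = n`. -/
def nodeSumCompl (t : ι → ℝ) (d : ι → ℂ) (n : ι) (z : ℂ) : ℂ :=
  ∑' m, if m = n then 0 else d m / (z - t m)

/-- This extracts the decay `1 / (1 + ‖z‖)` from each term, at the price of a power weight on the
coefficient that rapid decay can afford. -/
lemma weight_le_of_le_norm_sub {x : ℝ} {ρ : ℝ} (hρ : 0 < ρ) {z : ℂ} (hz : ρ ≤ ‖z - x‖) :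
    1 + ‖z‖ ≤ ‖z - x‖ * (1 + (1 + |x|) / ρ) := by
  have h1 : ‖z‖ ≤ ‖z - x‖ + |x| := by
    have := norm_add_le (z - x) x
    rwa [sub_add_cancel, Complex.norm_real, Real.norm_eq_abs] at this
  have h2 : 1 + |x| ≤ ‖z - x‖ * ((1 + |x|) / ρ) := by
    rw [mul_div_assoc', le_div_iff₀ hρ, mul_comm]
    gcongr
  linarith

variable (hr : ∀ m, 0 < r m) {n : ι} {z z' : ℂ} (hz : ∀ m, m ≠ n → r m ≤ ‖z - t m‖)

include hr hz in
lemma norm_compl_term_le (m : ι) : ‖if m = n then 0 else d m / (z - t m)‖ ≤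
    ‖d m‖ * (1 + (1 + |t m|) / r m) / (1 + ‖z‖) := by
  have := hr m
  split_ifs with hm
  · rw [norm_zero]; positivity
  · have h1 := weight_le_of_le_norm_sub (hr m) (hz m hm)
    rw [norm_div, div_le_div_iff₀ ((hr m).trans_le (hz m hm)) (by positivity), mul_assoc]
    refine mul_le_mul_of_nonneg_left ?_ (norm_nonneg _)
    linarith

include hr hz in
lemma norm_nodeSumCompl_le (hd : Summable fun m => ‖d m‖ * (1 + (1 + |t m|) / r m)) :
    ‖nodeSumCompl t d n z‖ ≤ (∑' m, ‖d m‖ * (1 + (1 + |t m|) / r m)) / (1 + ‖z‖) :=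
  tsum_of_norm_bounded (hd.hasSum.div_const _) (norm_compl_term_le hr hz)

include hr hz in
lemma norm_nodeSumCompl_sub_le (hz' : ∀ m, m ≠ n → r m ≤ ‖z' - t m‖)
    (hd : Summable fun m => ‖d m‖ * (1 + (1 + |t m|) / r m))
    (hd' : Summable fun m => ‖d m‖ * (1 + (1 + |t m|) / r m) / r m) :
    ‖nodeSumCompl t d n z - nodeSumCompl t d n z'‖ ≤
      (∑' m, ‖d m‖ * (1 + (1 + |t m|) / r m) / r m) / (1 + ‖z‖) * ‖z - z'‖ := by
  have h1 := Summable.of_norm_bounded (hd.div_const _) (norm_compl_term_le (d := d) hr hz)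
  have h2 := Summable.of_norm_bounded (hd.div_const _) (norm_compl_term_le (d := d) hr hz')
  rw [nodeSumCompl, nodeSumCompl, ← h1.tsum_sub h2]
  refine tsum_of_norm_bounded ((hd'.hasSum.div_const _).mul_right _) fun m => ?_
  have hrm := hr m
  by_cases hm : m = n
  · simp only [if_pos hm, sub_zero, norm_zero]
    positivity
  · have hzpos := (hr m).trans_le (hz m hm)
    have hzpos' := (hr m).trans_le (hz' m hm)
    have h3 := norm_compl_term_le (d := d) hr hz m
    simp only [if_neg hm] at h3 ⊢
    have e : d m / (z - t m) - d m / (z' - t m) =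
        d m / (z - t m) * ((z' - z) / (z' - t m)) := by
      have := norm_pos_iff.1 hzpos
      have := norm_pos_iff.1 hzpos'
      field_simp
      ring
    rw [e, norm_mul, norm_div (z' - z), norm_sub_rev z' z]
    calc ‖d m / (z - t m)‖ * (‖z - z'‖ / ‖z' - t m‖)
        ≤ ‖d m‖ * (1 + (1 + |t m|) / r m) / (1 + ‖z‖) * (‖z - z'‖ / r m) := by
          gcongr
          exact hz' m hm
      _ = _ := by ring

end Remainder

variable {I : Set ℤ} {t μ : I → ℝ} {δ : ℝ} {N : ℕ}

/-- The radii depend only on the separation, not on `f`. For distant `n`, the equation `1 + d n / (z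
- t n) + H z = 0`, with `H` the sum over the other nodes, is rewritten as `z = t n - d n / (1 + H
z)`. The node itself is a fixed point exactly when `d n = 0`, that is `a n = 0`, so fixed points
match both kinds of points in the zero set. -/
lemma IsAdmissible.exists_localizingRadii (h : IsAdmissible I t μ) (hδ : 0 < δ) (hδ1 : δ ≤ 1)
    (hsep : ∀ n m, n ≠ m → δ ≤ |t n - t m| * (1 + |t n|) ^ N)
    (hμ : ∀ k : ℕ, Summable fun n => μ n * (1 + |t n|) ^ k)
    (hnull : ∀ a : lp (fun _ : I => ℂ) 2, NullMoments t (coeffs μ a) → a = 0) :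
    ∃ r, LocalizingRadii t μ r := by
  classical
  have ht := h.tendsto_abs
  let r : I → ℝ := fun n => δ / 2 / (1 + |t n|) ^ N
  have hr : ∀ n, 0 < r n := fun n => by positivity
  have hr1 : ∀ n, r n ≤ 1 := fun n => by
    refine (div_le_self (by positivity) (one_le_pow₀ (by simp))).trans ?_
    linarith
  have hrsep : ∀ n m, n ≠ m → r n + r m ≤ |t n - t m| := fun n m hnm => by
    have key : ∀ n m, n ≠ m → 2 * r n ≤ |t n - t m| := fun n m hnm => by
      rw [show 2 * r n = δ / (1 + |t n|) ^ N by simp only [r]; ring, div_le_iff₀ (by positivity)]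
      exact hsep n m hnm
    have h1 := key n m hnm
    have h2 := key m n hnm.symm
    rw [abs_sub_comm] at h2
    linarith
  have hdisj : Pairwise fun n m : I =>
      Disjoint (Metric.ball (t n : ℂ) (r n)) (Metric.ball (t m : ℂ) (r m)) := fun n m hnm => by
    refine (disjoint_ball_ball_iff (hr n) (hr m)).2 ?_
    rw [Complex.dist_of_im_eq (by simp), Complex.ofReal_re,
      Complex.ofReal_re, Real.dist_eq]
    exact hrsep n m hnm
  refine ⟨r, hr, hdisj, fun a ha => ?_⟩
  have hμ0 := fun n => (h.mass_pos n).le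
  set c := coeffs μ a
  have hc : ∀ k : ℕ, Summable fun n => ‖c n‖ * (1 + |t n|) ^ k := summable_coeffs_mul_pow hμ0 hμ a
  -- Density enters only here: it provides a nonvanishing moment.
  have hex : ∃ K : ℕ, ∑' n, c n * (t n : ℂ) ^ K ≠ 0 := by
    by_contra! hcon
    exact ha (hnull a ⟨hc, hcon⟩)
  set K := Nat.find hex
  set M := ∑' n, c n * (t n : ℂ) ^ K
  have hM : M ≠ 0 := Nat.find_spec hex
  have hK : ∀ k < K, ∑' n, c n * (t n : ℂ) ^ k = 0 := fun k hk => not_not.1 (Nat.find_min hex hk)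
  let d : I → ℂ := fun n => c n * (t n : ℂ) ^ (K + 1) / M
  have hd : ∀ k : ℕ, Summable fun n => ‖d n‖ * (1 + |t n|) ^ k := fun k => by
    refine Summable.of_nonneg_of_le (fun n => by positivity) (fun n => ?_)
      ((hc (K + 1 + k)).div_const ‖M‖)
    have : |t n| ^ (K + 1) ≤ (1 + |t n|) ^ (K + 1) := by gcongr; linarith
    rw [norm_div, norm_mul, norm_pow, Complex.norm_real, Real.norm_eq_abs, div_mul_eq_mul_div,
      mul_assoc, pow_add _ (K + 1) k]
    gcongr
  have hQ : ∀ m, 1 + (1 + |t m|) / r m ≤ (1 + 2 / δ) * (1 + |t m|) ^ (N + 1) := fun m => by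
    have h1 : (1 + |t m|) / r m = 2 / δ * (1 + |t m|) ^ (N + 1) := by
      simp only [r]
      field_simp
      ring
    have h2 : (1 : ℝ) ≤ (1 + |t m|) ^ (N + 1) := one_le_pow₀ (by simp)
    rw [h1]
    linarith
  have hinvr : ∀ m, (r m)⁻¹ = 2 / δ * (1 + |t m|) ^ N := fun m => by
    simp only [r]
    field_simp
  have hs1 : Summable fun m => ‖d m‖ * (1 + (1 + |t m|) / r m) := by
    refine Summable.of_nonneg_of_le (fun m => by have := hr m; positivity) (fun m => ?_)
      ((hd (N + 1)).mul_left (1 + 2 / δ))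
    calc ‖d m‖ * (1 + (1 + |t m|) / r m) ≤ ‖d m‖ * ((1 + 2 / δ) * (1 + |t m|) ^ (N + 1)) := by
          gcongr
          exact hQ m
      _ = _ := by ring
  have hs2 : Summable fun m => ‖d m‖ * (1 + (1 + |t m|) / r m) / r m := by
    refine Summable.of_nonneg_of_le (fun m => by have := hr m; positivity) (fun m => ?_)
      ((hd (N + 1 + N)).mul_left ((1 + 2 / δ) * (2 / δ)))
    calc ‖d m‖ * (1 + (1 + |t m|) / r m) / r m
        ≤ ‖d m‖ * ((1 + 2 / δ) * (1 + |t m|) ^ (N + 1)) * (2 / δ * (1 + |t m|) ^ N) := by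
          rw [div_eq_mul_inv _ (r m), hinvr]
          gcongr
          exact hQ m
      _ = _ := by ring
  have hs3 : Summable fun m => ‖d m‖ / r m := by
    refine ((hd N).mul_left (2 / δ)).congr fun m => ?_
    rw [div_eq_mul_inv _ (r m), hinvr]
    ring
  set H₁ := ∑' m, ‖d m‖ * (1 + (1 + |t m|) / r m)
  set H₂ := ∑' m, ‖d m‖ * (1 + (1 + |t m|) / r m) / r m
  -- The four thresholds respectively exclude `0` from the disk, give `‖H‖ ≤ 1 / 2`, make `H`
  -- `1`-Lipschitz, and make the map contract by `1 / 2` into the ball of half the radius.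
  have hev : ∀ᶠ n in cofinite, 2 ≤ |t n| ∧ 2 * H₁ ≤ |t n| ∧ H₂ ≤ |t n| ∧ ‖d n‖ / r n ≤ 1 / 8 :=
    (ht.eventually_ge_atTop _).and ((ht.eventually_ge_atTop _).and
      ((ht.eventually_ge_atTop _).and (hs3.tendsto_cofinite_zero.eventually_le_const (by norm_num))))
  refine Set.Finite.subset hev fun n hn hgood => hn ?_
  obtain ⟨ht2, htH1, htH2, hdr⟩ := hgood
  rw [div_le_iff₀ (hr n)] at hdr
  have hoff : ∀ z ∈ Metric.ball (t n : ℂ) (r n), ∀ m, m ≠ n → r m ≤ ‖z - t m‖ := by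
    intro z hz m hm
    by_contra hlt
    refine Set.disjoint_left.1 (hdisj hm) ?_ hz
    rw [Metric.mem_ball, dist_eq_norm]
    exact not_le.1 hlt
  have hznorm : ∀ z ∈ Metric.ball (t n : ℂ) (r n), |t n| ≤ 1 + ‖z‖ := by
    intro z hz
    rw [Metric.mem_ball, dist_comm, dist_eq_norm] at hz
    have := norm_sub_norm_le (t n : ℂ) z
    rw [Complex.norm_real, Real.norm_eq_abs] at this
    linarith [hr1 n]
  let H : ℂ → ℂ := nodeSumCompl t d n
  have hH : ∀ z ∈ Metric.ball (t n : ℂ) (r n), ‖H z‖ ≤ 1 / 2 := fun z hz => by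
    refine (norm_nodeSumCompl_le hr (hoff z hz) hs1).trans ?_
    rw [div_le_iff₀ (by positivity)]
    linarith [hznorm z hz]
  have hHlip : ∀ z ∈ Metric.ball (t n : ℂ) (r n), ∀ z' ∈ Metric.ball (t n : ℂ) (r n),
      ‖H z - H z'‖ ≤ ‖z - z'‖ := fun z hz z' hz' => by
    refine (norm_nodeSumCompl_sub_le hr (hoff z hz) (hoff z' hz') hs1 hs2).trans ?_
    refine mul_le_of_le_one_left (norm_nonneg _) ?_
    rw [div_le_one (by positivity)]
    exact htH2.trans (hznorm z hz)
  have hH1 : ∀ z ∈ Metric.ball (t n : ℂ) (r n), 1 / 2 ≤ ‖1 + H z‖ := fun z hz => by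
    have := norm_sub_norm_le (1 : ℂ) (-H z)
    rw [norm_one, norm_neg, sub_neg_eq_add] at this
    linarith [hH z hz]
  have hH0 : ∀ z ∈ Metric.ball (t n : ℂ) (r n), 1 + H z ≠ 0 := fun z hz =>
    norm_pos_iff.1 (by linarith [hH1 z hz])
  let Φ : ℂ → ℂ := fun z => t n - d n / (1 + H z)
  have hfix : ∃! z : ℂ, z ∈ Metric.ball (t n : ℂ) (r n) ∧ Φ z = z := by
    refine existsUnique_fixedPoint_ball (hr n) (fun z hz => ?_) fun z hz z' hz' => ?_
    · have e : Φ z - t n = -(d n / (1 + H z)) := by simp only [Φ]; ring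
      rw [e, norm_neg, norm_div, div_le_iff₀ (by linarith [hH1 z hz])]
      nlinarith [hH1 z hz, hr n]
    · have e : Φ z - Φ z' = d n * (H z - H z') / ((1 + H z) * (1 + H z')) := by
        have := hH0 z hz
        have := hH0 z' hz'
        simp only [Φ]
        field_simp
        ring
      rw [e, norm_div, norm_mul, norm_mul]
      have h1 := hH1 z hz
      have h2 := hH1 z' hz'
      have h3 := hHlip z hz z' hz'
      have h4 : ‖d n‖ ≤ 1 / 8 := by linarith [hr1 n]
      rw [div_le_iff₀ (by positivity)]
      have h5 : (1 / 4 : ℝ) ≤ ‖1 + H z‖ * ‖1 + H z'‖ := by nlinarith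
      have h6 : ‖d n‖ * ‖H z - H z'‖ ≤ 1 / 8 * ‖z - z'‖ := by gcongr
      nlinarith [norm_nonneg (z - z')]
  have hiff : ∀ z : ℂ, z ∈ zeroSet t μ (cauchyTransform t μ a) ∩ Metric.ball (t n : ℂ) (r n) ↔
      z ∈ Metric.ball (t n : ℂ) (r n) ∧ Φ z = z := by
    intro z
    rw [Set.mem_inter_iff, and_comm]
    refine and_congr_right fun hz => ?_
    rw [h.mem_zeroSet]
    have hne : ∀ m, m ≠ n → z ≠ t m := fun m hm heq => by
      have := (hr m).trans_le (hoff z hz m hm)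
      rw [heq, sub_self, norm_zero] at this
      exact lt_irrefl _ this
    have hz0 : z ≠ 0 := fun h0 => by
      have := hznorm z hz
      rw [h0, norm_zero] at this
      linarith
    by_cases hzn : z = t n
    · have h1 : ¬ (∀ m, z ≠ t m) := fun hall => hall n hzn
      have h2 : (∃ m, z = t m ∧ a m = 0) ↔ a n = 0 := by
        refine ⟨fun ⟨m, hm, hm0⟩ => ?_, fun h0 => ⟨n, hzn, h0⟩⟩
        by_cases hmn : m = n
        · rwa [← hmn]
        · exact absurd hm (hne m hmn)
      have h3 : Φ z = z ↔ d n = 0 := by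
        simp only [Φ]
        rw [hzn, sub_eq_self, div_eq_zero_iff]
        exact or_iff_left (hzn ▸ hH0 z hz)
      have h4 : d n = 0 ↔ a n = 0 := by
        have h5 : (t n : ℂ) ≠ 0 := Complex.ofReal_ne_zero.2 (h.ne_zero n)
        have h6 : (Real.sqrt (μ n) : ℂ) ≠ 0 :=
          Complex.ofReal_ne_zero.2 (Real.sqrt_pos.2 (h.mass_pos n)).ne'
        simp [d, c, coeffs, hM, h5, h6]
      simp only [h1, false_and, false_or]
      rw [h2, h3, h4]
    · have hzall : ∀ m, z ≠ t m := fun m => by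
        by_cases hmn : m = n
        · rw [hmn]; exact hzn
        · exact hne m hmn
      have h1 : ¬ ∃ m, z = t m ∧ a m = 0 := fun ⟨m, hm, _⟩ => hzall m hm
      obtain ⟨C, -, hC⟩ := exists_weight_le ht hzall
      have hdw : Summable fun m => d m / (z - t m) := by
        refine summable_div_sub ?_ hzall hC
        refine Summable.of_nonneg_of_le (fun m => by positivity) (fun m => ?_) (hd 0)
        rw [pow_zero, mul_one]
        exact div_le_self (norm_nonneg _) (by simp)
      -- The vanishing of the moments below `K` gives `z ^ K * f`; one further power of `z` splits
      -- off the moment `M`.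
      have h2 : z ^ (K + 1) * nodeSum t c z = M * (1 + nodeSum t d z) := by
        have hcK := pow_mul_nodeSum ht hc hzall K hK
        have hsM := summable_mul_pow hc K
        rw [pow_succ', mul_assoc, hcK, mul_add, mul_one, nodeSum, nodeSum, ← tsum_mul_left,
          ← tsum_mul_left, ← hsM.tsum_add (hdw.mul_left M)]
        refine tsum_congr fun m => ?_
        have := sub_ne_zero.2 (hzall m)
        simp only [d]
        field_simp
        ring
      have h3 : nodeSum t d z = d n / (z - t n) + H z := hdw.tsum_eq_add_tsum_ite n
      have h4 : nodeSum t c z = 0 ↔ 1 + nodeSum t d z = 0 := by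
        constructor
        · intro h0
          rw [h0, mul_zero] at h2
          exact (mul_eq_zero.1 h2.symm).resolve_left hM
        · intro h0
          rw [h0, mul_zero] at h2
          exact (mul_eq_zero.1 h2).resolve_left (pow_ne_zero _ hz0)
      have h5 := sub_ne_zero.2 hzn
      have h6 := hH0 z hz
      have h7 : 1 + nodeSum t d z = 0 ↔ Φ z = z := by
        rw [h3]
        simp only [Φ]
        constructor
        · intro h0
          field_simp at h0 ⊢
          linear_combination -h0
        · intro h0
          field_simp at h0 ⊢
          linear_combination -h0
      simp only [h1, or_false]
      rw [and_iff_right hzall, h4, h7]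
  obtain ⟨z, hz, hzu⟩ := hfix
  exact ⟨z, (hiff z).2 hz, fun z' hz' => hzu z' ((hiff z').1 hz')⟩

end Sufficiency

end CauchyLocalization

end

theorem mainTheorem3 (I : Set ℤ) (t μ : I → ℝ)
    (h : CauchyLocalization.IsAdmissible I t μ)
    (hsep : CauchyLocalization.IsPowerSeparated t) :
    CauchyLocalization.StrongLocalization t μ ↔
      CauchyLocalization.PolynomialsInL2 (CauchyLocalization.discreteMeasure t μ) ∧
        CauchyLocalization.PolynomialsDenseInL2 (CauchyLocalization.discreteMeasure t μ) := by
  obtain ⟨δ, hδ, hδ1, N, hN⟩ := h.exists_separation hsep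
  have hinj := h.strictMono.injective
  rw [h.strongLocalization_iff]
  constructor
  · rintro ⟨r, hr⟩
    have hp := (CauchyLocalization.polynomialsInL2_iff h.mass_pos).2
      (hr.summable_mass_mul_pow h hδ hδ1 hN)
    exact ⟨hp, (CauchyLocalization.polynomialsDenseInL2_iff hinj h.mass_pos hp).2
      fun a ha => hr.eq_zero_of_nullMoments h hδ hδ1 hN ha⟩
  · rintro ⟨hp, hdense⟩
    exact h.exists_localizingRadii hδ hδ1 hN
      ((CauchyLocalization.polynomialsInL2_iff h.mass_pos).1 hp)
      ((CauchyLocalization.polynomialsDenseInL2_iff hinj h.mass_pos hp).1 hdense)
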